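/- Let $n\ge 2$ and let $M$ be a smooth $n$-manifold with slit tangent bundle $\mathcal TM=TM\setminus\{0\}$ and induced coordinates $(x^i,y^i)$. Let $\mathcal C=y^i\,\partial/\partial y^i$ be the Liouville field and $J=\partial/\partial y^i\otimes dx^i$. A spray is a smooth vector field $S$ on $\mathcal TM$ with $JS=\mathcal C$, $[\mathcal C,S]=S$; write $S=y^i\partial_{x^i}-2G^i\partial_{y^i}$ and $G^i_j=\partial G^i/\partial y^j$. A Finsler function is a continuous $F:TM\to\mathbb R$, smooth and positive on $\mathcal TM$, zero on the zero section, positively $1$-homogeneous in $y$, with $g_{ij}=\tfrac12\,\partial^2F^2/\partial y^i\partial y^j$ nondegenerate on $\mathcal TM$. Its geodesic spray is the spray $S$ with $i_S\,dd_JE=-dE$, $E=\tfrac12F^2$. A vector field on $\mathcal TM$ is (Finsler) metrizable if it is the geodesic spray of some Finsler function on $M$. A function $P$ on $\mathcal TM$ is holonomy invariant for $S$ if $P(\tau(v))=P(v)$ for every $v\in\mathcal TM$ and every parallel translation $\tau$ of the nonlinear connection of $S$ (parallel fields along a curve $x(t)$ are the solutions of $\dot y^i+G^i_j(x,y)\dot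 x^j=0$). The principal curvatures of $F$ at $v\in\mathcal T_xM$ are the eigenvalues $\kappa_1,\dots,\kappa_{n-1}$ of the Jacobi endomorphism $$R^i_j=2\frac{\partial G^i}{\partial x^j}-S(G^i_j)-G^i_kG^k_j$$ of its geodesic spray $S$ at $v$ that belong to eigenvectors $X_1,\dots,X_{n-1}$ which together with $v$ form a basis of $T_xM$; equivalently, as a set of numbers, the eigenvalues that have an eigenvector not proportional to $v$. **Statement.** Let $F$ be a Finsler function on $M$ with geodesic spray $S$, and let $\tilde P$ be a smooth function on $\mathcal TM$ that is holonomy invariant for $S$ and not identically zero. 1. If $\tilde S=S-2\tilde P\,\mathcal C$ is metrizable, then $$\tilde P^2+\kappa_\alpha=0\quad\text{for some principal curvature }\kappa_\alpha,\ \alpha\in\{1,\dots,n-1\},$$ at every point of the closure in $\mathcal TM$ of $\{\tilde P\neq0\}$, and $\kappa_\alpha\ne0$ wherever $\tilde P\neq 0$. In other words, there is a smooth function $\kappa$ on $\mathcal TM$ whose value at every point of this closure is a principal curvature of $F$ there, with $\tilde P^2+\kappa=0$ on this closure and $\kappa\neq0$ where $\tilde P\ne0$. In particular, if $\tilde P$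 vanishes nowhere (or only on a set with empty interior), the identity holds on all of $\mathcal TM$. 2. If all principal curvatures of $F$ are nonnegative at every point of $\mathcal TM$, then $S-2\tilde P\,\mathcal C$ is not metrizable. -/

import Mathlib

open scoped Manifold ContDiff Topology

noncomputable section

namespace FinslerSpray

variable {n : ℕ} {M : Type*} [TopologicalSpace M] [ChartedSpace (EuclideanSpace ℝ (Fin n)) M]
  [IsManifold (𝓡 n) ∞ M]

/-! ### The slit tangent bundle and coordinates on it -/

/-- The set of nonzero tangent vectors of `M`. -/
def slit (n : ℕ) (M : Type*) [TopologicalSpace M] [ChartedSpace (EuclideanSpace ℝ (Fin n)) M]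
    [IsManifold (𝓡 n) ∞ M] : Set (TangentBundle (𝓡 n) M) :=
  {v | v.2 ≠ 0}

/-- The induced coordinates `(x, y)` on the tangent bundle over the domain of the chart of `M`
at `x₀`. -/
def tchart (x₀ : M) : PartialEquiv (TangentBundle (𝓡 n) M)
    (EuclideanSpace ℝ (Fin n) × EuclideanSpace ℝ (Fin n)) :=
  extChartAt (𝓡 n).tangent (⟨x₀, 0⟩ : TangentBundle (𝓡 n) M)

/-- The components, in the coordinates `(x, y)` around `x₀`, of a vector field on the tangent
bundle. -/
def fieldInChart (S : ∀ v : TangentBundle (𝓡 n) M, TangentSpace (𝓡 n).tangent v) (x₀ : M)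
    (q : EuclideanSpace ℝ (Fin n) × EuclideanSpace ℝ (Fin n)) :
    EuclideanSpace ℝ (Fin n) × EuclideanSpace ℝ (Fin n) :=
  mfderiv (𝓡 n).tangent 𝓘(ℝ, EuclideanSpace ℝ (Fin n) × EuclideanSpace ℝ (Fin n))
    (tchart x₀) ((tchart x₀).symm q) (S ((tchart x₀).symm q))

/-! ### Sprays -/

/-- The Liouville vector field `C = yⁱ ∂/∂yⁱ`. A tangent vector of the tangent bundle at `v` is the
pair `(dx, dy)` of its components in the coordinates induced by the preferred chart at the foot
point of `v`, in which the fibre coordinate of `v` is `v.2`. -/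
def liouville (v : TangentBundle (𝓡 n) M) : TangentSpace (𝓡 n).tangent v :=
  ((0, v.2) : EuclideanSpace ℝ (Fin n) × EuclideanSpace ℝ (Fin n))

/-- The almost tangent structure `J = ∂/∂yⁱ ⊗ dxⁱ`. -/
def almostTangent (v : TangentBundle (𝓡 n) M) (ξ : TangentSpace (𝓡 n).tangent v) :
    TangentSpace (𝓡 n).tangent v :=
  ((0, (show EuclideanSpace ℝ (Fin n) × EuclideanSpace ℝ (Fin n) from ξ).1) :
    EuclideanSpace ℝ (Fin n) × EuclideanSpace ℝ (Fin n))

/-- A spray: a smooth vector field on the slit tangent bundle with `J S = C` and `[C, S] = S`.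
(The values of `S` on the zero section are irrelevant.) -/
structure IsSpray (S : ∀ v : TangentBundle (𝓡 n) M, TangentSpace (𝓡 n).tangent v) : Prop where
  smooth : ContMDiffOn (𝓡 n).tangent (𝓡 n).tangent.tangent ∞
    (fun v => (⟨v, S v⟩ : TangentBundle (𝓡 n).tangent (TangentBundle (𝓡 n) M))) (slit n M)
  almostTangent_eq : ∀ v ∈ slit n M, almostTangent v (S v) = liouville v
  bracket_eq : ∀ v ∈ slit n M,
    VectorField.mlieBracket (𝓡 n).tangent liouville S v = S v

/-- The projective deformation `S - 2 P C`. -/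
def deform (S : ∀ v : TangentBundle (𝓡 n) M, TangentSpace (𝓡 n).tangent v)
    (P : TangentBundle (𝓡 n) M → ℝ) (v : TangentBundle (𝓡 n) M) :
    TangentSpace (𝓡 n).tangent v :=
  S v - (2 * P v) • liouville v

/-- The spray coefficients `Gⁱ`, from `S = yⁱ ∂/∂xⁱ - 2 Gⁱ ∂/∂yⁱ`. -/
def coeff (S : ∀ v : TangentBundle (𝓡 n) M, TangentSpace (𝓡 n).tangent v) (x₀ : M)
    (q : EuclideanSpace ℝ (Fin n) × EuclideanSpace ℝ (Fin n)) : EuclideanSpace ℝ (Fin n) :=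
  (-(1 / 2) : ℝ) • (fieldInChart S x₀ q).2

/-- The connection coefficients `Gⁱⱼ = ∂Gⁱ/∂yʲ`, as the linear map `w ↦ Gⁱⱼ wʲ`. -/
def conn (S : ∀ v : TangentBundle (𝓡 n) M, TangentSpace (𝓡 n).tangent v) (x₀ : M)
    (q : EuclideanSpace ℝ (Fin n) × EuclideanSpace ℝ (Fin n)) :
    EuclideanSpace ℝ (Fin n) →L[ℝ] EuclideanSpace ℝ (Fin n) :=
  (fderiv ℝ (coeff S x₀) q).comp (ContinuousLinearMap.inr ℝ _ _)

/-- The Jacobi endomorphism, as the linear map `w ↦ Rⁱⱼ wʲ`, where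
`Rⁱⱼ = 2 ∂Gⁱ/∂xʲ - S(Gⁱⱼ) - Gⁱₖ Gᵏⱼ`. -/
def jacobi (S : ∀ v : TangentBundle (𝓡 n) M, TangentSpace (𝓡 n).tangent v) (x₀ : M)
    (q : EuclideanSpace ℝ (Fin n) × EuclideanSpace ℝ (Fin n)) :
    EuclideanSpace ℝ (Fin n) →L[ℝ] EuclideanSpace ℝ (Fin n) :=
  (2 : ℝ) • (fderiv ℝ (coeff S x₀) q).comp (ContinuousLinearMap.inl ℝ _ _)
    - fderiv ℝ (conn S x₀) q (fieldInChart S x₀ q)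
    - (conn S x₀ q).comp (conn S x₀ q)

/-! ### Finsler functions and geodesic sprays -/

/-- The energy `E = F² / 2`. -/
def energy (F : TangentBundle (𝓡 n) M → ℝ) (v : TangentBundle (𝓡 n) M) : ℝ := F v ^ 2 / 2

/-- The metric tensor `g = ∂²E/∂yⁱ∂yʲ` of `F` at the tangent vector `y` at `x`. -/
def metricTensor (F : TangentBundle (𝓡 n) M → ℝ) (x : M) (y u w : EuclideanSpace ℝ (Fin n)) : ℝ :=
  fderiv ℝ (fderiv ℝ (fun z : EuclideanSpace ℝ (Fin n) =>
    energy F (⟨x, z⟩ : TangentBundle (𝓡 n) M))) y u w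

/-- Finsler functions. -/
structure IsFinsler (F : TangentBundle (𝓡 n) M → ℝ) : Prop where
  continuous : Continuous F
  smooth : ContMDiffOn (𝓡 n).tangent 𝓘(ℝ, ℝ) ∞ F (slit n M)
  pos : ∀ v ∈ slit n M, 0 < F v
  zero : ∀ x : M, F (⟨x, 0⟩ : TangentBundle (𝓡 n) M) = 0
  homogeneous : ∀ (x : M) (y : TangentSpace (𝓡 n) x) (t : ℝ), 0 < t →
    F (⟨x, t • y⟩ : TangentBundle (𝓡 n) M) = t * F ⟨x, y⟩
  nondegenerate : ∀ (x : M) (y : EuclideanSpace ℝ (Fin n)), y ≠ 0 →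
    ∀ u : EuclideanSpace ℝ (Fin n), (∀ w, metricTensor F x y u w = 0) → u = 0

/-- The one-form `d_J L = dL ∘ J` in coordinates `(x, y)`. -/
def dJ (L : EuclideanSpace ℝ (Fin n) × EuclideanSpace ℝ (Fin n) → ℝ)
    (q : EuclideanSpace ℝ (Fin n) × EuclideanSpace ℝ (Fin n)) :
    (EuclideanSpace ℝ (Fin n) × EuclideanSpace ℝ (Fin n)) →L[ℝ] ℝ :=
  (fderiv ℝ L q).comp
    ((ContinuousLinearMap.inr ℝ _ _).comp (ContinuousLinearMap.fst ℝ _ _))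

/-- `S` is the geodesic spray of `F`: a spray with `i_S d d_J E = - dE` on nonzero vectors. The
equation between one-forms is written in each of the coordinate systems `(x, y)`, using
`dθ(X, Y) = (D_X θ)(Y) - (D_Y θ)(X)` for constant fields `X, Y`. -/
structure IsGeodesicSpray (F : TangentBundle (𝓡 n) M → ℝ)
    (S : ∀ v : TangentBundle (𝓡 n) M, TangentSpace (𝓡 n).tangent v) : Prop where
  isSpray : IsSpray S
  eulerLagrange : ∀ (x₀ : M), ∀ q ∈ (tchart (n := n) x₀).target, q.2 ≠ 0 →
    ∀ η : EuclideanSpace ℝ (Fin n) × EuclideanSpace ℝ (Fin n),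
      fderiv ℝ (dJ (energy F ∘ (tchart x₀).symm)) q (fieldInChart S x₀ q) η
        - fderiv ℝ (dJ (energy F ∘ (tchart x₀).symm)) q η (fieldInChart S x₀ q)
      = - fderiv ℝ (energy F ∘ (tchart x₀).symm) q η

/-- A vector field on the slit tangent bundle is Finsler metrizable if it is the geodesic spray of
some Finsler function. -/
def IsMetrizable (S : ∀ v : TangentBundle (𝓡 n) M, TangentSpace (𝓡 n).tangent v) : Prop :=
  ∃ F : TangentBundle (𝓡 n) M → ℝ, IsFinsler F ∧ IsGeodesicSpray F S

/-! ### Parallel translation and holonomy invariance -/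

/-- The curve `γ` of nonzero tangent vectors is, for parameters in `[a, b]`, a parallel vector field
along its base curve, with respect to the nonlinear connection of `S`: the velocity of `γ` is
horizontal, that is `dyⁱ/dt + Gⁱⱼ dxʲ/dt = 0`. (This condition does not depend on the chart.) -/
def IsParallel (S : ∀ v : TangentBundle (𝓡 n) M, TangentSpace (𝓡 n).tangent v)
    (γ : ℝ → TangentBundle (𝓡 n) M) (a b : ℝ) : Prop :=
  ∀ t ∈ Set.Icc a b, γ t ∈ slit n M ∧ ContMDiffAt 𝓘(ℝ, ℝ) (𝓡 n).tangent 1 γ t ∧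
    ∃ x₀ : M, γ t ∈ (tchart (n := n) x₀).source ∧
      (deriv (fun s => tchart x₀ (γ s)) t).2
        + conn S x₀ (tchart x₀ (γ t)) (deriv (fun s => tchart x₀ (γ s)) t).1 = 0

/-- `P` is invariant with respect to all parallel translations along curves. -/
def IsHolonomyInvariant (S : ∀ v : TangentBundle (𝓡 n) M, TangentSpace (𝓡 n).tangent v)
    (P : TangentBundle (𝓡 n) M → ℝ) : Prop :=
  ∀ (γ : ℝ → TangentBundle (𝓡 n) M) (a b : ℝ), a ≤ b → IsParallel S γ a b → P (γ a) = P (γ b)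

/-! ### Principal curvatures -/

/-- `κ` is (the value of) a principal curvature at `v`: an eigenvalue of the Jacobi endomorphism
with an eigenvector `X` not proportional to `v` (which corresponds to the trivial eigenvector field
`S`). This is expressed in the coordinates `(x, y)` around `v`; the choice does not matter. -/
def IsPrincipalCurvatureAt (S : ∀ v : TangentBundle (𝓡 n) M, TangentSpace (𝓡 n).tangent v)
    (v : TangentBundle (𝓡 n) M) (κ : ℝ) : Prop :=
  ∀ x₀ : M, v ∈ (tchart (n := n) x₀).source →
    ∃ X : EuclideanSpace ℝ (Fin n), X ∉ Submodule.span ℝ {(tchart (n := n) x₀ v).2} ∧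
      jacobi S x₀ (tchart x₀ v) X = κ • X

/-- `κ₁, …, κₙ₋₁` is the complete list of the principal curvatures at `v`: there are eigenvectors
`X₁, …, Xₙ₋₁` of the Jacobi endomorphism with these eigenvalues which form a basis together
with `v`. -/
def IsPrincipalCurvatureList (S : ∀ v : TangentBundle (𝓡 n) M, TangentSpace (𝓡 n).tangent v)
    (v : TangentBundle (𝓡 n) M) (κ : Fin (n - 1) → ℝ) : Prop :=
  ∃ x₀ : M, v ∈ (tchart (n := n) x₀).source ∧
    ∃ X : Fin (n - 1) → EuclideanSpace ℝ (Fin n),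
      LinearIndependent ℝ (fun o : Option (Fin (n - 1)) => o.elim (tchart (n := n) x₀ v).2 X) ∧
      ∀ α, jacobi S x₀ (tchart x₀ v) (X α) = κ α • X α

end FinslerSpray

end

/-! Write `f` for the energy of a Finsler function metrizing `S - 2PC`, `h` for the horizontal lift
of `S`, `R` for its Jacobi endomorphism, and let subscripts denote fibre derivatives.

Holonomy invariance says that `P` is constant in horizontal directions. The horizontal lift of the
deformed spray differs from `h u` by the vertical vector `P u + P_u y`, and `f` is constant along
it. Hence the derivative of `f` along `h u` is `P f_u + 2 f P_u`. The bracket of `S` with `h u`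
produces `R u`; applying this commutation relation to `P` and to `f` gives `P_{Ru} = 0` and `f_{Ru}
= -P² f_u + 2 P f P_u` (`vert_jac_apply`, `vert_jac_of_deformed`). So the one-form `ω(u) = P f_u - 2
f P_u` satisfies `ω ∘ (R + P²) = 0`, and by homogeneity `ω(y) = 0`.

Where `ω ≠ 0`, this makes `-P²` an eigenvalue of the transpose of `R`, hence of `R`. The form `ω`
cannot vanish on an open set where `P ≠ 0`: there `f` would be `c(x) P²` with `P` affine in the
fibres, and the Hessian of `f` would have rank at most one (`exists_vert_ne`). By density and
continuity of a determinant, the eigenvalue persists on the closure of `{P ≠ 0}`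
(`exists_jac_eigenvector`). The second claim follows, since `-P² < 0` at some point.

The argument is carried out for functions on an open subset of `V × V` and then transferred to
charts of the tangent bundle. -/

noncomputable section

namespace FinslerSpray

/-! ### Calculus of sprays, horizontal lifts and the Jacobi endomorphism in coordinates. -/

section Calculus

variable {V : Type*} [NormedAddCommGroup V] [NormedSpace ℝ V]
  {W : Type*} [NormedAddCommGroup W] [NormedSpace ℝ W]

/-- The fibre derivative of a function of `(x, y)`. -/
def vert (f : V × V → W) (q : V × V) : V →L[ℝ] W :=
  (fderiv ℝ f q).comp (ContinuousLinearMap.inr ℝ V V)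

/-- The spray with coefficients `G`. -/
def sprayOf (G : V × V → V) (q : V × V) : V × V := (q.2, -((2 : ℝ) • G q))

/-- The horizontal lift with respect to the nonlinear connection of `G`. -/
def hlift (G : V × V → V) (q : V × V) (u : V) : V × V := (u, -(vert G q u))

/-- The Jacobi endomorphism of the spray with coefficients `G`. -/
def jac (G : V × V → V) (q : V × V) : V →L[ℝ] V :=
  (2 : ℝ) • (fderiv ℝ G q).comp (ContinuousLinearMap.inl ℝ V V)
    - fderiv ℝ (vert G) q (sprayOf G q) - (vert G q).comp (vert G q)

@[simp] lemma vert_apply (f : V × V → W) (q : V × V) (u : V) :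
    vert f q u = fderiv ℝ f q (0, u) := rfl

lemma jac_apply (G : V × V → V) (q : V × V) (u : V) :
    jac G q u = (2 : ℝ) • fderiv ℝ G q (u, 0) - fderiv ℝ (vert G) q (sprayOf G q) u
      - vert G q (vert G q u) := rfl

lemma _root_.ContDiffAt.vert {f : V × V → W} {q : V × V} (hf : ContDiffAt ℝ ∞ f q) :
    ContDiffAt ℝ ∞ (vert f) q :=
  (hf.fderiv_right (m := ∞) (by simp)).clm_comp contDiffAt_const

lemma _root_.ContDiffAt.differentiableAt_infty {f : V → W} {q : V} (hf : ContDiffAt ℝ ∞ f q) :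
    DifferentiableAt ℝ f q := hf.differentiableAt (by simp)

lemma _root_.ContDiffAt.fderiv_infty {f : V → W} {q : V} (hf : ContDiffAt ℝ ∞ f q) :
    ContDiffAt ℝ ∞ (fderiv ℝ f) q := hf.fderiv_right (by simp)

lemma fderiv_fderiv_comm {f : V → ℝ} {q : V} (hf : ContDiffAt ℝ ∞ f q) (a b : V) :
    fderiv ℝ (fderiv ℝ f) q a b = fderiv ℝ (fderiv ℝ f) q b a :=
  (hf.isSymmSndFDerivAt (by simpa using WithTop.coe_le_coe.2 (le_top : (2 : ℕ∞) ≤ ⊤))).eq a b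

/-- The derivative of `q ↦ Df(q)(g(q))`. -/
lemma fderiv_fderiv_apply {f : V → W} {g : V → V} {q : V} (hf : ContDiffAt ℝ ∞ f q)
    (hg : DifferentiableAt ℝ g q) (a : V) :
    fderiv ℝ (fun p => fderiv ℝ f p (g p)) q a
      = fderiv ℝ (fderiv ℝ f) q a (g q) + fderiv ℝ f q (fderiv ℝ g q a) := by
  rw [fderiv_clm_apply hf.fderiv_infty.differentiableAt_infty hg]
  simp [add_comm]

lemma fderiv_vert_apply {f : V × V → W} {q : V × V} (hf : ContDiffAt ℝ ∞ f q) (a : V × V) (u : V) :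
    fderiv ℝ (vert f) q a u = fderiv ℝ (fderiv ℝ f) q a (0, u) := by
  have h : vert f = fun p => (fderiv ℝ f p).comp (ContinuousLinearMap.inr ℝ V V) := rfl
  rw [h, fderiv_clm_comp hf.fderiv_infty.differentiableAt_infty (by fun_prop)]
  simp

lemma fderiv_eq_of_eqOn {f g : V → W} {U : Set V} (hU : IsOpen U) (h : ∀ q ∈ U, f q = g q)
    {q : V} (hq : q ∈ U) : fderiv ℝ f q = fderiv ℝ g q :=
  Filter.EventuallyEq.fderiv_eq (Filter.eventuallyEq_of_mem (hU.mem_nhds hq) h)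

variable {U : Set (V × V)} {G : V × V → V}

lemma fderiv_sprayOf {q : V × V} (hG : DifferentiableAt ℝ G q) (a : V × V) :
    fderiv ℝ (sprayOf G) q a = (a.2, -((2 : ℝ) • fderiv ℝ G q a)) := by
  have h1 : HasFDerivAt (sprayOf G) ((ContinuousLinearMap.snd ℝ V V).prod
      (-((2 : ℝ) • fderiv ℝ G q))) q :=
    hasFDerivAt_snd.prodMk (hG.hasFDerivAt.const_smul (2 : ℝ)).neg
  rw [h1.fderiv]; rfl

lemma differentiableAt_sprayOf {q : V × V} (hG : DifferentiableAt ℝ G q) :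
    DifferentiableAt ℝ (sprayOf G) q :=
  differentiableAt_snd.prodMk (hG.const_smul (2 : ℝ)).neg

lemma fderiv_hlift {q : V × V} (hG : ContDiffAt ℝ ∞ G q) (u : V) (a : V × V) :
    fderiv ℝ (fun p => hlift G p u) q a = (0, -(fderiv ℝ (vert G) q a u)) := by
  have h0 := (ContDiffAt.vert hG).differentiableAt_infty.hasFDerivAt
  have h1 : HasFDerivAt (fun p => hlift G p u) ((0 : V × V →L[ℝ] V).prod
      (-((fderiv ℝ (vert G) q).flip u))) q := by
    refine (hasFDerivAt_const u q).prodMk (HasFDerivAt.neg ?_)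
    simpa using h0.clm_apply (hasFDerivAt_const u q)
  rw [h1.fderiv]; rfl

lemma differentiableAt_hlift {q : V × V} (hG : ContDiffAt ℝ ∞ G q) (u : V) :
    DifferentiableAt ℝ (fun p => hlift G p u) q :=
  (differentiableAt_const u).prodMk
    ((ContDiffAt.vert hG).differentiableAt_infty.clm_apply (differentiableAt_const u)).neg

lemma hlift_self (hhom : ∀ q ∈ U, vert G q q.2 = (2 : ℝ) • G q) {q : V × V} (hq : q ∈ U) :
    hlift G q q.2 = sprayOf G q := by
  simp only [hlift, sprayOf, hhom q hq]

/-- If the horizontal derivatives of `f` are given by `β`, then the Jacobi endomorphism satisfies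
the contracted commutation identity. -/
lemma vert_jac_apply (hU : IsOpen U) (hG : ∀ q ∈ U, ContDiffAt ℝ ∞ G q)
    (hhom : ∀ q ∈ U, vert G q q.2 = (2 : ℝ) • G q) {f : V × V → ℝ}
    (hf : ∀ q ∈ U, ContDiffAt ℝ ∞ f q) {β : V × V → V →L[ℝ] ℝ}
    (hβ : ∀ q ∈ U, DifferentiableAt ℝ β q)
    (hfβ : ∀ q ∈ U, ∀ u, fderiv ℝ f q (hlift G q u) = β q u) {q : V × V} (hq : q ∈ U) (u : V) :
    vert f q (jac G q u) = fderiv ℝ β q (sprayOf G q) u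
      - fderiv ℝ (fun p => β p p.2) q (hlift G q u) - β q (vert G q u) := by
  have hGd := (hG q hq).differentiableAt_infty
  -- the derivative of `Df(S) = β(y)`
  have h1 : ∀ a, fderiv ℝ (fderiv ℝ f) q a (sprayOf G q)
      + fderiv ℝ f q (a.2, -((2 : ℝ) • fderiv ℝ G q a))
      = fderiv ℝ (fun p => β p p.2) q a := by
    intro a
    have e := fderiv_eq_of_eqOn (f := fun p => fderiv ℝ f p (sprayOf G p))
      (g := fun p => β p p.2) hU (fun p hp => by rw [← hlift_self hhom hp, hfβ p hp]) hq
    rw [← e, fderiv_fderiv_apply (hf q hq) (differentiableAt_sprayOf hGd), fderiv_sprayOf hGd]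
  -- the derivative of `Df(h u) = β u`
  have h2 : ∀ a, fderiv ℝ (fderiv ℝ f) q a (hlift G q u)
      + fderiv ℝ f q (0, -(fderiv ℝ (vert G) q a u)) = fderiv ℝ β q a u := by
    intro a
    have e := fderiv_eq_of_eqOn (f := fun p => fderiv ℝ f p (hlift G p u))
      (g := fun p => β p u) hU (fun p hp => hfβ p hp u) hq
    have e' : fderiv ℝ (fun p => β p u) q a = fderiv ℝ β q a u := by
      rw [fderiv_clm_apply (hβ q hq) (differentiableAt_const u)]; simp
    rw [← e', ← e, fderiv_fderiv_apply (hf q hq) (differentiableAt_hlift (hG q hq) u),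
      fderiv_hlift (hG q hq)]
  have a1 := h1 (hlift G q u)
  have a2 := h2 (sprayOf G q)
  have a3 := hfβ q hq (vert G q u)
  -- Symmetry of the second derivative cancels the second-order terms of `a1` and `a2`; what remains
  -- is `f` differentiated along the bracket of `h u` and `S`.
  rw [fderiv_fderiv_comm (hf q hq)] at a1
  have key : fderiv ℝ G q (hlift G q u) = fderiv ℝ G q (u, 0) - vert G q (vert G q u) := by
    rw [vert_apply, ← map_sub]; simp [hlift]
  -- The bracket `D S (h u) - D (h u) S` splits into the horizontal part `-h(N u)`, with `N = vert
  -- G`, and the vertical part `-R u`.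
  have e1 : ((hlift G q u).2, -((2 : ℝ) • fderiv ℝ G q (hlift G q u)))
      = -(hlift G q (vert G q u)) - (0, jac G q u) + (0, -(fderiv ℝ (vert G) q (sprayOf G q) u)) := by
    rw [key, jac_apply]
    ext
    · simp [hlift]
    · simp only [hlift, Prod.snd_add, Prod.snd_sub, Prod.snd_neg]; module
  rw [e1, map_add, map_sub, map_neg, a3] at a1
  rw [vert_apply f]
  linarith

/-- A function with vanishing horizontal derivatives is invariant under the Jacobi endomorphism. -/
lemma vert_jac_eq_zero (hU : IsOpen U) (hG : ∀ q ∈ U, ContDiffAt ℝ ∞ G q)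
    (hhom : ∀ q ∈ U, vert G q q.2 = (2 : ℝ) • G q) {f : V × V → ℝ}
    (hf : ∀ q ∈ U, ContDiffAt ℝ ∞ f q)
    (hfh : ∀ q ∈ U, ∀ u, fderiv ℝ f q (hlift G q u) = 0) {q : V × V} (hq : q ∈ U) (u : V) :
    vert f q (jac G q u) = 0 := by
  rw [vert_jac_apply hU hG hhom hf (β := fun _ => 0) (fun _ _ => differentiableAt_const _)
    (by simpa using hfh) hq u]
  simp

/-- Euler's relation differentiated in an arbitrary direction; it holds on an open set, so
differentiation is legitimate. -/
lemma fderiv_apply_snd_of_homogeneous (hU : IsOpen U) {f : V × V → W} {c : ℝ}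
    (hf : ∀ q ∈ U, ContDiffAt ℝ ∞ f q) (hhom : ∀ q ∈ U, vert f q q.2 = c • f q)
    {q : V × V} (hq : q ∈ U) (a : V × V) :
    fderiv ℝ (fderiv ℝ f) q a (0, q.2) + fderiv ℝ f q (0, a.2) = c • fderiv ℝ f q a := by
  have e := fderiv_eq_of_eqOn (f := fun p => fderiv ℝ f p (0, p.2)) (g := fun p => c • f p) hU
    hhom hq
  have h0 : HasFDerivAt (fun p : V × V => ((0 : V), p.2))
      ((0 : V × V →L[ℝ] V).prod (ContinuousLinearMap.snd ℝ V V)) q :=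
    (hasFDerivAt_const (0 : V) q).prodMk hasFDerivAt_snd
  have e1 := fderiv_fderiv_apply (hf q hq) h0.differentiableAt a
  rw [e, h0.fderiv, fderiv_fun_const_smul (hf q hq).differentiableAt_infty] at e1
  simpa using e1.symm

/-- The energy is constant along horizontal directions of the geodesic spray. -/
lemma fderiv_hlift_eq_zero_of_eulerLagrange (hU : IsOpen U) (hG : ∀ q ∈ U, ContDiffAt ℝ ∞ G q)
    {f : V × V → ℝ} (hf : ∀ q ∈ U, ContDiffAt ℝ ∞ f q)
    (hfhom : ∀ q ∈ U, vert f q q.2 = (2 : ℝ) • f q)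
    (hEL : ∀ q ∈ U, ∀ u, fderiv ℝ (fderiv ℝ f) q (sprayOf G q) (0, u)
      - fderiv ℝ (fderiv ℝ f) q (u, 0) (0, q.2) = - fderiv ℝ f q (u, 0))
    {q : V × V} (hq : q ∈ U) (u : V) : fderiv ℝ f q (hlift G q u) = 0 := by
  -- Euler's relation differentiated along `(u, 0)` evaluates the mixed term of the Euler–Lagrange
  -- equation as `2 Df(u, 0)`.
  have h1 : ∀ p ∈ U, ∀ u, fderiv ℝ (fderiv ℝ f) p (sprayOf G p) (0, u) = fderiv ℝ f p (u, 0) := by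
    intro p hp u
    have e := fderiv_apply_snd_of_homogeneous hU hf hfhom hp (u, 0)
    have e' := hEL p hp u
    have : fderiv ℝ f p (0, ((u, 0) : V × V).2) = 0 := by
      rw [show ((0 : V), ((u, 0) : V × V).2) = 0 from rfl, map_zero]
    rw [this] at e
    simp only [smul_eq_mul] at e
    linarith
  have split : ∀ p : V × V, ∀ a b : V, fderiv ℝ f p (a, b)
      = fderiv ℝ f p (a, 0) + fderiv ℝ f p (0, b) := by
    intro p a b; rw [← map_add]; simp
  -- Conservation of energy: the differentiated Euler relation along `S` reads `Df(S) = 2 Df(S)`.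
  have h2 : ∀ p ∈ U, fderiv ℝ f p (sprayOf G p) = 0 := by
    intro p hp
    have e := fderiv_apply_snd_of_homogeneous hU hf hfhom hp (sprayOf G p)
    rw [h1 p hp] at e
    have : fderiv ℝ f p (sprayOf G p) = fderiv ℝ f p (p.2, 0)
        + fderiv ℝ f p (0, (sprayOf G p).2) := split p _ _
    simp only [smul_eq_mul] at e
    linarith
  have hGd := (hG q hq).differentiableAt_infty
  have e := fderiv_eq_of_eqOn (f := fun p => fderiv ℝ f p (sprayOf G p)) (g := fun _ => (0 : ℝ)) hU
    h2 hq
  -- Differentiating `Df(S) = 0` in the fibre direction `u` yields `Df(u, 0) + Df(u, -2 N u) = 0`,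
  -- which is twice the claim.
  have e2 := fderiv_fderiv_apply (hf q hq) (differentiableAt_sprayOf hGd) (0, u)
  rw [e, fderiv_sprayOf hGd, fderiv_fderiv_comm (hf q hq), h1 q hq] at e2
  have e3 := split q u (-(vert G q u))
  have e4 := split q u (-((2 : ℝ) • vert G q u))
  have e5 : fderiv ℝ f q (0, -((2 : ℝ) • vert G q u)) = 2 * fderiv ℝ f q (0, -(vert G q u)) := by
    rw [← smul_eq_mul, ← (fderiv ℝ f q).map_smul, Prod.smul_mk, smul_zero, smul_neg]
  simp only [vert_apply] at e3 e4 e5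
  simp only [fderiv_fun_const, Pi.zero_apply, zero_apply] at e2
  simp only [hlift, vert_apply]
  linarith

end Calculus

/-! ### The eigenvalue `-P²` of the Jacobi endomorphism, in coordinates. -/

section LocalTheorem

variable {V : Type*} [NormedAddCommGroup V] [NormedSpace ℝ V]
  {U : Set (V × V)} {G : V × V → V}

/-- The derivative along the spray of the fibre derivatives of `f`, where `β` gives the horizontal
derivatives of `f`. -/
lemma fderiv_fderiv_sprayOf (hU : IsOpen U) (hG : ∀ q ∈ U, ContDiffAt ℝ ∞ G q)
    (hhom : ∀ q ∈ U, vert G q q.2 = (2 : ℝ) • G q) {f : V × V → ℝ}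
    (hf : ∀ q ∈ U, ContDiffAt ℝ ∞ f q) {β : V × V → V →L[ℝ] ℝ}
    (hfβ : ∀ q ∈ U, ∀ u, fderiv ℝ f q (hlift G q u) = β q u) {q : V × V} (hq : q ∈ U) (u : V) :
    fderiv ℝ (fderiv ℝ f) q (sprayOf G q) (0, u)
      = fderiv ℝ (fun p => β p p.2) q (0, u) - β q u + vert f q (vert G q u) := by
  have hGd := (hG q hq).differentiableAt_infty
  have e := fderiv_eq_of_eqOn (f := fun p => fderiv ℝ f p (sprayOf G p))
    (g := fun p => β p p.2) hU (fun p hp => by rw [← hlift_self hhom hp, hfβ p hp]) hq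
  have e1 := fderiv_fderiv_apply (hf q hq) (differentiableAt_sprayOf hGd) (0, u)
  rw [e, fderiv_sprayOf hGd, fderiv_fderiv_comm (hf q hq)] at e1
  have e2 : (((0, u) : V × V).2, -((2 : ℝ) • fderiv ℝ G q (0, u)))
      = hlift G q u - (0, vert G q u) := by
    ext
    · simp [hlift]
    · simp only [hlift, Prod.snd_sub, vert_apply]; module
  rw [e2, map_sub, hfβ q hq] at e1
  rw [vert_apply f]
  linarith

variable {f P : V × V → ℝ}

/-- The identity satisfied by the energy of a Finsler function metrizing the deformed spray. -/
lemma vert_jac_of_deformed (hU : IsOpen U) (hG : ∀ q ∈ U, ContDiffAt ℝ ∞ G q)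
    (hhom : ∀ q ∈ U, vert G q q.2 = (2 : ℝ) • G q)
    (hP : ∀ q ∈ U, ContDiffAt ℝ ∞ P q) (hPhom : ∀ q ∈ U, vert P q q.2 = P q)
    (hPh : ∀ q ∈ U, ∀ u, fderiv ℝ P q (hlift G q u) = 0)
    (hf : ∀ q ∈ U, ContDiffAt ℝ ∞ f q) (hfhom : ∀ q ∈ U, vert f q q.2 = (2 : ℝ) • f q)
    (hfh : ∀ q ∈ U, ∀ u,
      fderiv ℝ f q (hlift G q u) = P q * vert f q u + 2 * f q * vert P q u)
    {q : V × V} (hq : q ∈ U) (u : V) :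
    vert f q (jac G q u) = -(P q) ^ 2 * vert f q u + 2 * P q * f q * vert P q u := by
  set β : V × V → V →L[ℝ] ℝ := fun p => P p • vert f p + (2 * f p) • vert P p with hβdef
  have hfβ : ∀ q ∈ U, ∀ u, fderiv ℝ f q (hlift G q u) = β q u := by
    intro p hp u; rw [hfh p hp u]; rfl
  have hPd := (hP q hq).differentiableAt_infty
  have hfd := (hf q hq).differentiableAt_infty
  have hPv := (ContDiffAt.vert (hP q hq)).differentiableAt_infty
  have hfv := (ContDiffAt.vert (hf q hq)).differentiableAt_infty
  have hβd : ∀ p ∈ U, DifferentiableAt ℝ β p := fun p hp =>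
    ((hP p hp).differentiableAt_infty.smul
      (ContDiffAt.vert (hf p hp)).differentiableAt_infty).add
    (((hf p hp).differentiableAt_infty.const_mul 2).smul
      (ContDiffAt.vert (hP p hp)).differentiableAt_infty)
  have hby : ∀ p ∈ U, β p p.2 = 4 * (P p * f p) := by
    intro p hp
    have h1 := hPhom p hp
    have h2 := hfhom p hp
    simp only [hβdef, add_apply, smul_apply, h1, h2,
      smul_eq_mul]
    ring
  have hDb : ∀ a, fderiv ℝ (fun p => β p p.2) q a
      = 4 * (P q * fderiv ℝ f q a + f q * fderiv ℝ P q a) := by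
    intro a
    rw [fderiv_eq_of_eqOn hU hby hq, fderiv_const_mul (hPd.fun_mul hfd), fderiv_fun_mul hPd hfd]
    simp only [add_apply, smul_apply, smul_eq_mul]
  -- Each factor has a known derivative along `S`: `P` is constant, `f` grows at rate `β(y) = 4 P
  -- f`, and `fderiv_fderiv_sprayOf` handles the fibre derivatives.
  have hDβ : fderiv ℝ β q (sprayOf G q) u
      = fderiv ℝ P q (sprayOf G q) * vert f q u
        + P q * fderiv ℝ (fderiv ℝ f) q (sprayOf G q) (0, u)
        + (2 * fderiv ℝ f q (sprayOf G q)) * vert P q u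
        + 2 * f q * fderiv ℝ (fderiv ℝ P) q (sprayOf G q) (0, u) := by
    rw [hβdef, fderiv_fun_add (hPd.fun_smul hfv) ((hfd.const_mul 2).fun_smul hPv), fderiv_fun_smul hPd hfv,
      fderiv_fun_smul (hfd.const_mul 2) hPv, fderiv_const_mul hfd, ← fderiv_vert_apply (hf q hq),
      ← fderiv_vert_apply (hP q hq)]
    simp only [add_apply, smul_apply, ContinuousLinearMap.smulRight_apply, smul_eq_mul]
    ring
  have k1 := fderiv_fderiv_sprayOf hU hG hhom hf hfβ hq u
  have k2 := fderiv_fderiv_sprayOf hU hG hhom hP (β := fun _ => 0) (by simpa using hPh) hq u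
  have k3 : fderiv ℝ P q (sprayOf G q) = 0 := by rw [← hlift_self hhom hq, hPh q hq]
  have k4 : fderiv ℝ f q (sprayOf G q) = 4 * (P q * f q) := by
    rw [← hlift_self hhom hq, hfβ q hq, hby q hq]
  have k5 := vert_jac_apply hU hG hhom hf hβd hfβ hq u
  have k6 : ∀ w, β q w = P q * vert f q w + 2 * f q * vert P q w := fun w => rfl
  rw [hDβ, k1, k2, k3, k4, hDb, hDb, hPh q hq, hfβ q hq, k6, k6, ← vert_apply, ← vert_apply] at k5
  simp only [zero_apply, fderiv_fun_const, Pi.zero_apply] at k5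
  rw [k5]; ring

/-- The fibre derivatives of `f` and `P²` are not proportional on any open set on which `P` does not
vanish. -/
lemma exists_vert_ne (hV : 2 ≤ Module.finrank ℝ V) (hU : IsOpen U) (hne : U.Nonempty)
    (hP : ∀ q ∈ U, ContDiffAt ℝ ∞ P q) (hP0 : ∀ q ∈ U, P q ≠ 0)
    (hPh : ∀ q ∈ U, ∀ u, fderiv ℝ P q (hlift G q u) = 0)
    (hf : ∀ q ∈ U, ContDiffAt ℝ ∞ f q)
    (hfh : ∀ q ∈ U, ∀ u,
      fderiv ℝ f q (hlift G q u) = P q * vert f q u + 2 * f q * vert P q u)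
    (hf0 : ∀ q ∈ U, 0 < f q)
    (hnd : ∀ q ∈ U, ∀ u, (∀ w, fderiv ℝ (fderiv ℝ f) q (0, u) (0, w) = 0) → u = 0) :
    ∃ q ∈ U, ∃ u, P q * vert f q u - 2 * f q * vert P q u ≠ 0 := by
  by_contra! hω
  set c : V × V → ℝ := fun p => f p / P p ^ 2 with hc
  have hcs : ∀ q ∈ U, ContDiffAt ℝ ∞ c q := fun q hq =>
    (hf q hq).div ((hP q hq).pow 2) (pow_ne_zero 2 (hP0 q hq))
  have hfc : ∀ q ∈ U, f q = c q * P q ^ 2 := fun q hq => by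
    have := hP0 q hq; simp only [hc]; field_simp
  have hDf : ∀ q ∈ U, ∀ a, fderiv ℝ f q a
      = P q ^ 2 * fderiv ℝ c q a + 2 * c q * P q * fderiv ℝ P q a := by
    intro q hq a
    have hPd := (hP q hq).differentiableAt_infty
    have hcd := (hcs q hq).differentiableAt_infty
    rw [fderiv_eq_of_eqOn hU hfc hq, fderiv_fun_mul hcd (hPd.fun_pow 2), fderiv_fun_pow 2 hPd]
    simp only [add_apply, smul_apply, smul_eq_mul]
    ring
  -- With `f = c P²`, the form `ω` is `P³` times the fibre derivative of `c`, so `c` depends on `x`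
  -- alone.
  have hcv : ∀ q ∈ U, ∀ u, fderiv ℝ c q (0, u) = 0 := by
    intro q hq u
    have h1 := hω q hq u
    have h2 := hDf q hq (0, u)
    rw [vert_apply, vert_apply, h2, hfc q hq] at h1
    have h3 : P q ^ 3 * fderiv ℝ c q (0, u) = 0 := by linarith
    exact (mul_eq_zero.1 h3).resolve_left (pow_ne_zero 3 (hP0 q hq))
  have hch : ∀ q ∈ U, ∀ u, fderiv ℝ c q (u, 0) = 4 * c q * vert P q u := by
    intro q hq u
    have h1 := hω q hq u
    have h2 := hDf q hq (hlift G q u)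
    have h3 : fderiv ℝ c q (hlift G q u) = fderiv ℝ c q (u, 0) := by
      have : hlift G q u = (u, 0) + (0, -(vert G q u)) := by simp [hlift]
      rw [this, map_add, hcv q hq, add_zero]
    rw [hfh q hq, hPh q hq, h3] at h2
    have h4 : P q ^ 2 * (fderiv ℝ c q (u, 0) - 4 * c q * vert P q u) = 0 := by
      have := hfc q hq
      rw [this] at h1 h2
      linarith
    have := (mul_eq_zero.1 h4).resolve_left (pow_ne_zero 2 (hP0 q hq))
    linarith
  -- The base derivative `4 c P_u` of `c` has zero fibre derivative, because mixed partials commute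
  -- and `c` has no fibre derivative. As `c ≠ 0`, the fibre Hessian of `P` vanishes.
  have hPP : ∀ q ∈ U, ∀ u w, fderiv ℝ (fderiv ℝ P) q (0, w) (0, u) = 0 := by
    intro q hq u w
    have hcd := (hcs q hq).differentiableAt_infty
    have hcc := (hcs q hq).fderiv_infty.differentiableAt_infty
    have hPv := (ContDiffAt.vert (hP q hq)).differentiableAt_infty
    have e1 : fderiv ℝ (fderiv ℝ c) q (u, 0) (0, w) = 0 := by
      have e := fderiv_eq_of_eqOn (f := fun p => fderiv ℝ c p (0, w)) (g := fun _ => (0 : ℝ)) hU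
        (fun p hp => hcv p hp w) hq
      have e' := fderiv_fderiv_apply (hcs q hq) (differentiableAt_const (0, w)) (u, 0)
      rw [e] at e'
      simpa using e'.symm
    have e2 : fderiv ℝ (fderiv ℝ c) q (0, w) (u, 0)
        = 4 * c q * fderiv ℝ (fderiv ℝ P) q (0, w) (0, u) := by
      have e := fderiv_eq_of_eqOn (f := fun p => fderiv ℝ c p (u, 0))
        (g := fun p => 4 * c p * vert P p u) hU (fun p hp => hch p hp u) hq
      have e' := fderiv_fderiv_apply (hcs q hq) (differentiableAt_const (u, 0)) (0, w)
      rw [e, fderiv_fun_mul (hcd.const_mul 4) (hPv.clm_apply (differentiableAt_const u)),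
        fderiv_clm_apply hPv (differentiableAt_const u), fderiv_const_mul hcd] at e'
      simp only [add_apply, smul_apply, smul_eq_mul, hcv q hq, fderiv_fun_const, Pi.zero_apply,
        ContinuousLinearMap.comp_zero, zero_apply, map_zero, add_zero, zero_add, mul_zero,
        ContinuousLinearMap.flip_apply, fderiv_vert_apply (hP q hq)] at e'
      exact e'.symm
    rw [fderiv_fderiv_comm (hcs q hq), e2] at e1
    have : c q ≠ 0 := fun h => (hf0 q hq).ne' (by rw [hfc q hq, h, zero_mul])
    exact (mul_eq_zero.1 e1).resolve_left (mul_ne_zero (by norm_num) this)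
  obtain ⟨q, hq⟩ := hne
  have hfin : FiniteDimensional ℝ V := Module.finite_of_finrank_pos (by omega)
  obtain ⟨u, hu, hu0⟩ : ∃ u, vert P q u = 0 ∧ u ≠ 0 := by
    have hk : LinearMap.ker (vert P q : V →ₗ[ℝ] ℝ) ≠ ⊥ :=
      LinearMap.ker_ne_bot_of_finrank_lt (by rw [Module.finrank_self]; omega)
    obtain ⟨u, hu, hu0⟩ := (Submodule.ne_bot_iff _).1 hk
    exact ⟨u, hu, hu0⟩
  -- The fibre Hessian of `f` is now `2 c P_u P_w`, so a nonzero `u` in the kernel of `vert P`,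
  -- available since `dim V ≥ 2`, contradicts nondegeneracy.
  refine hu0 (hnd q hq u fun w => ?_)
  have hPd := (hP q hq).differentiableAt_infty
  have hcd := (hcs q hq).differentiableAt_infty
  have hPv := (ContDiffAt.vert (hP q hq)).differentiableAt_infty
  have e := fderiv_eq_of_eqOn (f := fun p => fderiv ℝ f p (0, w))
    (g := fun p => 2 * c p * P p * vert P p w) hU
    (fun p hp => by rw [hDf p hp, hcv p hp, mul_zero, zero_add]; rfl) hq
  have e' := fderiv_fderiv_apply (hf q hq) (differentiableAt_const (0, w)) (0, u)
  rw [vert_apply] at hu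
  rw [e, fderiv_fun_mul ((hcd.const_mul 2).fun_mul hPd) (hPv.clm_apply (differentiableAt_const w)),
    fderiv_fun_mul (hcd.const_mul 2) hPd,
    fderiv_clm_apply hPv (differentiableAt_const w), fderiv_const_mul hcd] at e'
  simp only [add_apply, smul_apply, smul_eq_mul, hcv q hq, fderiv_fun_const, Pi.zero_apply,
    ContinuousLinearMap.comp_zero, zero_apply, map_zero, add_zero, zero_add, mul_zero,
    ContinuousLinearMap.flip_apply, fderiv_vert_apply (hP q hq), hPP q hq, hu] at e'
  exact e'.symm

/-- At the closure of the nonvanishing set of the projective factor `P`, the number `-P²` is an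
eigenvalue of the Jacobi endomorphism with an eigenvector not proportional to the position. -/
theorem exists_jac_eigenvector (hV : 2 ≤ Module.finrank ℝ V) (hU : IsOpen U)
    (hG : ∀ q ∈ U, ContDiffAt ℝ ∞ G q)
    (hhom : ∀ q ∈ U, vert G q q.2 = (2 : ℝ) • G q)
    (hP : ∀ q ∈ U, ContDiffAt ℝ ∞ P q) (hPhom : ∀ q ∈ U, vert P q q.2 = P q)
    (hPh : ∀ q ∈ U, ∀ u, fderiv ℝ P q (hlift G q u) = 0)
    (hf : ∀ q ∈ U, ContDiffAt ℝ ∞ f q) (hfhom : ∀ q ∈ U, vert f q q.2 = (2 : ℝ) • f q)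
    (hfh : ∀ q ∈ U, ∀ u,
      fderiv ℝ f q (hlift G q u) = P q * vert f q u + 2 * f q * vert P q u)
    (hf0 : ∀ q ∈ U, 0 < f q)
    (hnd : ∀ q ∈ U, ∀ u, (∀ w, fderiv ℝ (fderiv ℝ f) q (0, u) (0, w) = 0) → u = 0)
    {E : V × V → ℝ} (hE : ∀ q ∈ U, ContDiffAt ℝ ∞ E q)
    (hEhom : ∀ q ∈ U, vert E q q.2 = (2 : ℝ) • E q)
    (hEh : ∀ q ∈ U, ∀ u, fderiv ℝ E q (hlift G q u) = 0) (hE0 : ∀ q ∈ U, 0 < E q)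
    {q : V × V} (hq : q ∈ U) (hcl : q ∈ closure {p | p ∈ U ∧ P p ≠ 0}) :
    ∃ X, X ∉ Submodule.span ℝ {q.2} ∧ jac G q X = (-(P q) ^ 2) • X := by
  have hfin : FiniteDimensional ℝ V := Module.finite_of_finrank_pos (by omega)
  have : CompleteSpace V := FiniteDimensional.complete ℝ V
  -- Where `P = 0`, the determinant of `R + P²` vanishes trivially because `R y = 0`. The extra term
  -- `E_u y` makes `y` an eigenvector with eigenvalue `P² + 2E > 0`, so a kernel vector of `A` is
  -- never proportional to `y`. It does not disturb `ω ∘ A = 0`, since `ω(y) = 0`.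
  set A : V × V → V →L[ℝ] V := fun p => jac G p + (P p ^ 2) • ContinuousLinearMap.id ℝ V
    + (vert E p).smulRight p.2 with hA
  have hAc : ContinuousOn A U := by
    intro p hp
    have c1 : ContinuousAt (fun p => fderiv ℝ G p) p := (hG p hp).fderiv_infty.continuousAt
    have c2 : ContinuousAt (vert G) p := (ContDiffAt.vert (hG p hp)).continuousAt
    have c3 : ContinuousAt (fderiv ℝ (vert G)) p :=
      (ContDiffAt.vert (hG p hp)).fderiv_infty.continuousAt
    have c4 : ContinuousAt P p := (hP p hp).continuousAt
    have c5 : ContinuousAt (vert E) p := (ContDiffAt.vert (hE p hp)).continuousAt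
    have c6 : ContinuousAt G p := (hG p hp).continuousAt
    have c7 : ContinuousAt (sprayOf G) p := continuousAt_snd.prodMk (c6.const_smul (2 : ℝ)).neg
    have c8 : ContinuousAt (fun p => (vert E p).smulRight p.2) p :=
      ContinuousAt.comp (g := fun r : (V →L[ℝ] ℝ) × V => r.1.smulRight r.2)
        (ContinuousLinearMap.smulRightL ℝ V V).continuous₂.continuousAt (c5.prodMk continuousAt_snd)
    have c9 : ContinuousAt (jac G) p :=
      (((c1.clm_comp continuousAt_const).const_smul (2 : ℝ)).sub (c3.clm_apply c7)).sub
        (c2.clm_comp c2)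
    exact ((c9.add ((c4.pow 2).smul continuousAt_const)).add c8).continuousWithinAt
  have hAapp : ∀ p w, A p w = jac G p w + (P p ^ 2) • w + vert E p w • p.2 := fun p w => rfl
  -- If `A` were surjective, `ω ∘ A = 0` would force `ω = 0`.
  have hdet0 : ∀ p ∈ U, ∀ u, P p * vert f p u - 2 * f p * vert P p u ≠ 0 → (A p).det = 0 := by
    intro p hp u hu
    by_contra hdet
    have hunit : IsUnit (LinearMap.det (A p : V →ₗ[ℝ] V)) := isUnit_iff_ne_zero.2 hdet
    have hsurj : Function.Surjective (A p : V →ₗ[ℝ] V) :=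
      (LinearEquiv.ofIsUnitDet (v := Module.finBasis ℝ V) (v' := Module.finBasis ℝ V)
        (f := (A p : V →ₗ[ℝ] V)) (by rwa [LinearMap.det_toMatrix])).surjective
    obtain ⟨w, hw⟩ := hsurj u
    have hw' : A p w = u := hw
    apply hu
    rw [← hw', hAapp]
    have k1 := vert_jac_of_deformed hU hG hhom hP hPhom hPh hf hfhom hfh hp w
    have k2 := vert_jac_eq_zero hU hG hhom hP hPh hp w
    have k3 := hfhom p hp
    have k4 := hPhom p hp
    rw [map_add, map_add, map_add, map_add, k1, k2, map_smul, map_smul, map_smul, map_smul, k3, k4]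
    simp only [smul_eq_mul]
    ring
  have hdetq : (A q).det = 0 := by
    by_contra hdet
    -- A nonzero determinant at `q` stays nonzero nearby, hence on a nonempty open set where `P ≠
    -- 0`; there `exists_vert_ne` supplies a point with `ω ≠ 0`.
    have hcont : ContinuousOn (fun p => (A p).det) U :=
      ContinuousLinearMap.continuous_det.comp_continuousOn hAc
    obtain hW := hcont.isOpen_inter_preimage hU (isOpen_compl_singleton (x := (0 : ℝ)))
    obtain ⟨p, hp, hpU, hpP⟩ := mem_closure_iff.1 hcl _ hW ⟨hq, hdet⟩
    have hPc : ContinuousOn P U := fun p hp => (hP p hp).continuousAt.continuousWithinAt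
    have hW2 := (hPc.isOpen_inter_preimage hU (isOpen_compl_singleton (x := (0 : ℝ)))).inter hW
    have hsub : ∀ r ∈ U ∩ P ⁻¹' {0}ᶜ ∩ (U ∩ (fun p => (A p).det) ⁻¹' {0}ᶜ), r ∈ U :=
      fun r hr => hr.1.1
    obtain ⟨r, hr, u, hu⟩ := exists_vert_ne (G := G) hV hW2 ⟨p, ⟨hpU, hpP⟩, hp⟩
      (fun r hr => hP r (hsub r hr)) (fun r hr => hr.1.2) (fun r hr => hPh r (hsub r hr))
      (fun r hr => hf r (hsub r hr)) (fun r hr => hfh r (hsub r hr))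
      (fun r hr => hf0 r (hsub r hr)) (fun r hr => hnd r (hsub r hr))
    exact hr.2.2 (hdet0 r (hsub r hr) u hu)
  obtain ⟨X, hX, hX0⟩ := (Submodule.ne_bot_iff _).1
    (LinearMap.bot_lt_ker_of_det_eq_zero (f := (A q : V →ₗ[ℝ] V)) hdetq).ne'
  have hX' : A q X = 0 := hX
  rw [hAapp] at hX'
  -- Applying `vert E` to `A X = 0` removes `R X`, because `E` is horizontally constant, and leaves
  -- `(P² + 2E) E_X = 0`.
  have hEX : vert E q X = 0 := by
    have k := congrArg (vert E q) hX'
    have k3 := hEhom q hq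
    rw [map_add, map_add, vert_jac_eq_zero hU hG hhom hE hEh hq, map_smul, map_smul, k3,
      map_zero] at k
    have k' : (P q ^ 2 + 2 * E q) * vert E q X = 0 := by
      simp only [smul_eq_mul] at k
      linarith
    have := hE0 q hq
    exact (mul_eq_zero.1 k').resolve_left (by positivity)
  refine ⟨X, fun hmem => ?_, ?_⟩
  · obtain ⟨t, rfl⟩ := Submodule.mem_span_singleton.1 hmem
    have k3 := hEhom q hq
    rw [map_smul, k3] at hEX
    have := hE0 q hq
    simp only [smul_eq_mul, mul_eq_zero, OfNat.ofNat_ne_zero, this.ne', or_false] at hEX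
    exact hX0 (by rw [hEX, zero_smul])
  · rw [hEX, zero_smul, add_zero] at hX'
    rw [neg_smul]
    exact eq_neg_of_add_eq_zero_left hX'

/-- The position vector is in the kernel of the Jacobi endomorphism. -/
lemma jac_self (hU : IsOpen U) (hG : ∀ q ∈ U, ContDiffAt ℝ ∞ G q)
    (hhom : ∀ q ∈ U, vert G q q.2 = (2 : ℝ) • G q) {q : V × V} (hq : q ∈ U) :
    jac G q q.2 = 0 := by
  have hGd := (hG q hq).differentiableAt_infty
  have e := fderiv_apply_snd_of_homogeneous hU hG hhom hq (sprayOf G q)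
  have e1 : fderiv ℝ G q (sprayOf G q) = fderiv ℝ G q (q.2, 0) - (2 : ℝ) • vert G q (G q) := by
    rw [vert_apply, ← map_smul, ← map_sub]
    simp [sprayOf]
  have e2 : fderiv ℝ G q (0, (sprayOf G q).2) = -((2 : ℝ) • vert G q (G q)) := by
    rw [vert_apply, ← map_smul, ← map_neg]
    simp [sprayOf]
  rw [e1, e2] at e
  have h2 := hhom q hq
  rw [jac_apply, fderiv_vert_apply (hG q hq), h2, map_smul]
  have e3 := sub_eq_zero.2 e
  rw [← neg_eq_zero]
  refine Eq.trans ?_ e3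
  module

end LocalTheorem

/-! ### Induced coordinates on the slit tangent bundle. -/

section

variable {n : ℕ} {M : Type*} [TopologicalSpace M] [ChartedSpace (EuclideanSpace ℝ (Fin n)) M]
  [IsManifold (𝓡 n) ∞ M]

lemma tchart_apply (x₀ : M) (v : TangentBundle (𝓡 n) M) :
    tchart x₀ v = (extChartAt (𝓡 n) x₀ v.proj, tangentCoordChange (𝓡 n) v.proj x₀ v.proj v.2) := rfl

lemma mem_tchart_source {x₀ : M} {v : TangentBundle (𝓡 n) M} :
    v ∈ (tchart (n := n) x₀).source ↔ v.proj ∈ (extChartAt (𝓡 n) x₀).source := by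
  rw [tchart, extChartAt_source, extChartAt_source, TangentBundle.mem_chart_source_iff]

lemma mem_tchart_source_self (v : TangentBundle (𝓡 n) M) :
    v ∈ (tchart (n := n) v.proj).source :=
  mem_tchart_source.2 (mem_extChartAt_source _)

lemma mem_tchart_target {x₀ : M} {q : EuclideanSpace ℝ (Fin n) × EuclideanSpace ℝ (Fin n)} :
    q ∈ (tchart (n := n) x₀).target ↔ q.1 ∈ (extChartAt (𝓡 n) x₀).target := by
  have h := TangentBundle.mem_chart_target_iff (I := 𝓡 n) (M := M) q ⟨x₀, 0⟩
  rw [tchart, extChartAt_target, extChartAt_target, ModelWithCorners.range_eq_univ,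
    ModelWithCorners.range_eq_univ, Set.inter_univ, Set.inter_univ]
  exact h

lemma isOpen_tchart_target (x₀ : M) : IsOpen (tchart (n := n) x₀).target :=
  isOpen_extChartAt_target _

lemma tchart_symm_apply {x₀ : M} {q : EuclideanSpace ℝ (Fin n) × EuclideanSpace ℝ (Fin n)}
    (hq : q ∈ (tchart (n := n) x₀).target) :
    (tchart x₀).symm q = (⟨(extChartAt (𝓡 n) x₀).symm q.1,
      tangentCoordChange (𝓡 n) x₀ ((extChartAt (𝓡 n) x₀).symm q.1)
        ((extChartAt (𝓡 n) x₀).symm q.1) q.2⟩ : TangentBundle (𝓡 n) M) := by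
  have h1 : (extChartAt (𝓡 n) x₀).symm q.1 ∈ (extChartAt (𝓡 n) x₀).source :=
    (extChartAt (𝓡 n) x₀).map_target (mem_tchart_target.1 hq)
  symm
  refine ((tchart (n := n) x₀).eq_symm_apply (mem_tchart_source.2 h1) hq).2 ?_
  refine Prod.ext ((extChartAt (𝓡 n) x₀).right_inv (mem_tchart_target.1 hq)) ?_
  exact (tangentCoordChange_comp ⟨⟨h1, mem_extChartAt_source _⟩, h1⟩).trans
    (tangentCoordChange_self h1)

/-- The image of the slit tangent bundle in the coordinates around `x₀`. -/
def slitTarget (x₀ : M) : Set (EuclideanSpace ℝ (Fin n) × EuclideanSpace ℝ (Fin n)) :=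
  {q | q ∈ (tchart (n := n) x₀).target ∧ q.2 ≠ 0}

lemma isOpen_slitTarget (x₀ : M) : IsOpen (slitTarget (n := n) x₀) :=
  (isOpen_tchart_target x₀).inter (isOpen_ne_fun continuous_snd continuous_const)

lemma tangentCoordChange_symm_apply {x₀ x : M} (hx : x ∈ (extChartAt (𝓡 n) x₀).source)
    (y : EuclideanSpace ℝ (Fin n)) :
    tangentCoordChange (𝓡 n) x x₀ x (tangentCoordChange (𝓡 n) x₀ x x y) = y :=
  (tangentCoordChange_comp ⟨⟨hx, mem_extChartAt_source _⟩, hx⟩).trans (tangentCoordChange_self hx)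

lemma tangentCoordChange_apply_symm {x₀ x : M} (hx : x ∈ (extChartAt (𝓡 n) x₀).source)
    (y : EuclideanSpace ℝ (Fin n)) :
    tangentCoordChange (𝓡 n) x₀ x x (tangentCoordChange (𝓡 n) x x₀ x y) = y :=
  (tangentCoordChange_comp ⟨⟨mem_extChartAt_source _, hx⟩, mem_extChartAt_source _⟩).trans
    (tangentCoordChange_self (mem_extChartAt_source _))

lemma tchart_symm_mem_slit {x₀ : M} {q : EuclideanSpace ℝ (Fin n) × EuclideanSpace ℝ (Fin n)}
    (hq : q ∈ slitTarget (n := n) x₀) : (tchart x₀).symm q ∈ slit n M := by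
  rw [tchart_symm_apply hq.1]
  intro h
  have h1 := (extChartAt (𝓡 n) x₀).map_target (mem_tchart_target.1 hq.1)
  apply hq.2
  rw [← tangentCoordChange_symm_apply h1 q.2]
  exact (congrArg _ h).trans (map_zero _)

lemma tchart_mem_slitTarget {x₀ : M} {v : TangentBundle (𝓡 n) M} (hv : v ∈ slit n M)
    (hx : v ∈ (tchart (n := n) x₀).source) : tchart x₀ v ∈ slitTarget (n := n) x₀ := by
  refine ⟨(tchart x₀).map_source hx, fun h => hv ?_⟩
  have h1 := tangentCoordChange_apply_symm (mem_tchart_source.1 hx) v.2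
  rw [← h1]
  exact (congrArg _ h).trans (map_zero _)

lemma isOpen_slit : IsOpen (slit n M) := by
  rw [isOpen_iff_mem_nhds]
  intro v hv
  have hs := mem_tchart_source_self v
  have h1 := (isOpen_slitTarget v.proj).mem_nhds (tchart_mem_slitTarget hv hs)
  have h2 := (continuousAt_extChartAt (I := (𝓡 n).tangent) v).preimage_mem_nhds h1
  filter_upwards [h2, extChartAt_source_mem_nhds (I := (𝓡 n).tangent) v] with w hw hws
  have h3 := tchart_symm_mem_slit hw
  have h4 : (tchart v.proj).symm (extChartAt (𝓡 n).tangent v w) = w :=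
    (tchart (n := n) v.proj).left_inv hws
  rwa [h4] at h3

lemma contMDiffAt_tchart_symm {x₀ : M}
    {q : EuclideanSpace ℝ (Fin n) × EuclideanSpace ℝ (Fin n)}
    (hq : q ∈ (tchart (n := n) x₀).target) :
    ContMDiffAt 𝓘(ℝ, EuclideanSpace ℝ (Fin n) × EuclideanSpace ℝ (Fin n)) (𝓡 n).tangent ∞
      (tchart (n := n) x₀).symm q :=
  (contMDiffOn_extChartAt_symm (⟨x₀, 0⟩ : TangentBundle (𝓡 n) M)).contMDiffAt
    ((isOpen_tchart_target x₀).mem_nhds hq)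

lemma contMDiffAt_tchart {x₀ : M} {v : TangentBundle (𝓡 n) M}
    (hv : v ∈ (tchart (n := n) x₀).source) :
    ContMDiffAt (𝓡 n).tangent 𝓘(ℝ, EuclideanSpace ℝ (Fin n) × EuclideanSpace ℝ (Fin n)) ∞
      (tchart (n := n) x₀) v :=
  contMDiffAt_extChartAt' (by rwa [tchart, extChartAt_source] at hv)

/-- The coordinate expression of a smooth function on the slit tangent bundle is smooth. -/
lemma contDiffAt_comp_tchart_symm {f : TangentBundle (𝓡 n) M → ℝ}
    (hf : ContMDiffOn (𝓡 n).tangent 𝓘(ℝ, ℝ) ∞ f (slit n M)) {x₀ : M}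
    {q : EuclideanSpace ℝ (Fin n) × EuclideanSpace ℝ (Fin n)} (hq : q ∈ slitTarget (n := n) x₀) :
    ContDiffAt ℝ ∞ (f ∘ (tchart x₀).symm) q := by
  rw [← contMDiffAt_iff_contDiffAt]
  exact (hf.contMDiffAt (isOpen_slit.mem_nhds (tchart_symm_mem_slit hq))).comp q
    (contMDiffAt_tchart_symm hq.1)

lemma smul_mem_slitTarget {x₀ : M} {q : EuclideanSpace ℝ (Fin n) × EuclideanSpace ℝ (Fin n)}
    (hq : q ∈ slitTarget (n := n) x₀) {t : ℝ} (ht : t ≠ 0) :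
    (q.1, t • q.2) ∈ slitTarget (n := n) x₀ :=
  ⟨mem_tchart_target.2 (mem_tchart_target.1 hq.1), smul_ne_zero ht hq.2⟩

/-- Euler's relation. -/
lemma fderiv_snd_of_homogeneous {V W : Type*} [NormedAddCommGroup V] [NormedSpace ℝ V]
    [NormedAddCommGroup W] [NormedSpace ℝ W] {f : V × V → W} {q : V × V} (k : ℕ)
    (hf : DifferentiableAt ℝ f q) (hhom : ∀ t : ℝ, 0 < t → f (q.1, t • q.2) = t ^ k • f q) :
    fderiv ℝ f q (0, q.2) = (k : ℝ) • f q := by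
  have hc : HasDerivAt (fun t : ℝ => (q.1, t • q.2)) ((0 : V), q.2) 1 := by
    refine (hasDerivAt_const _ _).prodMk ?_
    simpa using (hasDerivAt_id (1 : ℝ)).smul_const q.2
  have h1 : HasDerivAt (fun t : ℝ => f (q.1, t • q.2)) (fderiv ℝ f q (0, q.2)) 1 := by
    refine HasFDerivAt.comp_hasDerivAt (1 : ℝ) ?_ hc
    simpa using hf.hasFDerivAt
  have h2 : HasDerivAt (fun t : ℝ => t ^ k • f q) ((k : ℝ) • f q) 1 := by
    simpa using (hasDerivAt_pow k (1 : ℝ)).smul_const (f q)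
  refine h1.unique (h2.congr_of_eventuallyEq ?_)
  filter_upwards [lt_mem_nhds (zero_lt_one' ℝ)] with t ht using hhom t ht

/-- The derivative of a coordinate change of the tangent bundle. -/
lemma tangentCoordChange_tangent_fst {x₀ : M} {v : TangentBundle (𝓡 n) M}
    (hv : v ∈ (tchart (n := n) x₀).source)
    (a : EuclideanSpace ℝ (Fin n) × EuclideanSpace ℝ (Fin n)) :
    (tangentCoordChange (𝓡 n).tangent v ⟨x₀, 0⟩ v a).1
      = tangentCoordChange (𝓡 n) v.proj x₀ v.proj a.1 := by
  have hd : HasFDerivAt (tchart x₀ ∘ (tchart v.proj).symm)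
      (tangentCoordChange (𝓡 n).tangent v ⟨x₀, 0⟩ v) (tchart v.proj v) := by
    have := hasFDerivWithinAt_tangentCoordChange (I := (𝓡 n).tangent) (x := v)
      (y := (⟨x₀, 0⟩ : TangentBundle (𝓡 n) M)) (z := v) ⟨mem_extChartAt_source _, hv⟩
    rwa [ModelWithCorners.range_eq_univ, hasFDerivWithinAt_univ] at this
  have hd0 : HasFDerivAt (extChartAt (𝓡 n) x₀ ∘ (extChartAt (𝓡 n) v.proj).symm)
      (tangentCoordChange (𝓡 n) v.proj x₀ v.proj) (extChartAt (𝓡 n) v.proj v.proj) := by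
    have := hasFDerivWithinAt_tangentCoordChange (I := 𝓡 n) (x := v.proj)
      (y := x₀) (z := v.proj) ⟨mem_extChartAt_source _, mem_tchart_source.1 hv⟩
    rwa [ModelWithCorners.range_eq_univ, hasFDerivWithinAt_univ] at this
  have h1 := hasFDerivAt_fst.comp (tchart v.proj v) hd
  have hfst : HasFDerivAt (Prod.fst : _ → EuclideanSpace ℝ (Fin n))
      (ContinuousLinearMap.fst ℝ (EuclideanSpace ℝ (Fin n)) (EuclideanSpace ℝ (Fin n)))
      (tchart v.proj v) := hasFDerivAt_fst
  have h2 := HasFDerivAt.comp (tchart v.proj v)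
    (g := extChartAt (𝓡 n) x₀ ∘ (extChartAt (𝓡 n) v.proj).symm) hd0 hfst
  -- The base component of a coordinate change of the tangent bundle depends on the base point only.
  have h3 : (Prod.fst ∘ (tchart x₀ ∘ (tchart v.proj).symm))
      =ᶠ[𝓝 (tchart v.proj v)]
      ((extChartAt (𝓡 n) x₀ ∘ (extChartAt (𝓡 n) v.proj).symm) ∘ Prod.fst) := by
    filter_upwards [(isOpen_tchart_target v.proj).mem_nhds
      ((tchart (n := n) v.proj).map_source (mem_tchart_source_self v))] with p hp
    simp only [Function.comp_apply]
    rw [tchart_symm_apply hp]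
    rfl
  have h4 := (h2.congr_of_eventuallyEq h3).unique h1
  exact (congrArg (fun L => L a) h4).symm

lemma tchart_proj_self (v : TangentBundle (𝓡 n) M) :
    tchart v.proj v = (extChartAt (𝓡 n) v.proj v.proj, v.2) :=
  Prod.ext rfl (tangentCoordChange_self (mem_extChartAt_source _))

/-- The fibre component of a coordinate change is linear in `y`, so Euler's relation of degree one
computes its derivative along `(0, y)`. -/
lemma tangentCoordChange_tangent_liouville {x₀ : M} {v : TangentBundle (𝓡 n) M}
    (hv : v ∈ (tchart (n := n) x₀).source) :
    tangentCoordChange (𝓡 n).tangent v ⟨x₀, 0⟩ v (liouville v) = (0, (tchart x₀ v).2) := by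
  have hd : HasFDerivAt (tchart x₀ ∘ (tchart v.proj).symm)
      (tangentCoordChange (𝓡 n).tangent v ⟨x₀, 0⟩ v) (tchart v.proj v) := by
    have := hasFDerivWithinAt_tangentCoordChange (I := (𝓡 n).tangent) (x := v)
      (y := (⟨x₀, 0⟩ : TangentBundle (𝓡 n) M)) (z := v) ⟨mem_extChartAt_source _, hv⟩
    rwa [ModelWithCorners.range_eq_univ, hasFDerivWithinAt_univ] at this
  have hs := mem_tchart_source_self v
  have ht := (tchart (n := n) v.proj).map_source hs
  have hinv : (tchart v.proj).symm (tchart v.proj v) = v := (tchart v.proj).left_inv hs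
  have h1 := fderiv_snd_of_homogeneous (f := Prod.snd ∘ (tchart x₀ ∘ (tchart v.proj).symm))
    (q := tchart v.proj v) 1 (hasFDerivAt_snd.comp (tchart v.proj v) hd).differentiableAt ?_
  · rw [(hasFDerivAt_snd.comp (tchart v.proj v) hd).fderiv] at h1
    refine Prod.ext ?_ ?_
    · exact (tangentCoordChange_tangent_fst hv _).trans (map_zero _)
    · have h2 : (liouville v : EuclideanSpace ℝ (Fin n) × EuclideanSpace ℝ (Fin n))
          = (0, (tchart v.proj v).2) := by rw [tchart_proj_self]; rfl
      simp only [Function.comp_apply, hinv, Nat.cast_one, one_smul] at h1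
      rw [← h1]
      exact congrArg (fun a => (tangentCoordChange (𝓡 n).tangent v ⟨x₀, 0⟩ v a).2) h2
  · intro t _
    have ht' : ((tchart v.proj v).1, t • (tchart v.proj v).2) ∈ (tchart (n := n) v.proj).target :=
      mem_tchart_target.2 (mem_tchart_target.1 ht)
    simp only [Function.comp_apply]
    rw [tchart_symm_apply ht', tchart_symm_apply ht, tchart_apply, tchart_apply, pow_one]
    dsimp only
    exact (congrArg _ (map_smul _ t _)).trans (map_smul _ t _)

end

/-! ### Sprays in coordinates. -/

section

variable {n : ℕ} {M : Type*} [TopologicalSpace M] [ChartedSpace (EuclideanSpace ℝ (Fin n)) M]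
  [IsManifold (𝓡 n) ∞ M]
  {S : ∀ v : TangentBundle (𝓡 n) M, TangentSpace (𝓡 n).tangent v}
  {x₀ : M} {q : EuclideanSpace ℝ (Fin n) × EuclideanSpace ℝ (Fin n)}

lemma mfderiv_tchart {v : TangentBundle (𝓡 n) M} (hv : v ∈ (tchart (n := n) x₀).source) :
    mfderiv (𝓡 n).tangent 𝓘(ℝ, EuclideanSpace ℝ (Fin n) × EuclideanSpace ℝ (Fin n))
      (tchart x₀) v = tangentCoordChange (𝓡 n).tangent v ⟨x₀, 0⟩ v := by
  rw [((contMDiffAt_tchart hv).mdifferentiableAt (by simp)).mfderiv]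
  rfl

lemma fieldInChart_eq (hq : q ∈ (tchart (n := n) x₀).target) :
    fieldInChart S x₀ q = tangentCoordChange (𝓡 n).tangent ((tchart x₀).symm q) ⟨x₀, 0⟩
      ((tchart x₀).symm q) (S ((tchart x₀).symm q)) := by
  rw [fieldInChart, mfderiv_tchart ((tchart x₀).map_target hq)]
  rfl

lemma fieldInChart_liouville (hq : q ∈ (tchart (n := n) x₀).target) :
    fieldInChart (liouville (n := n) (M := M)) x₀ q = (0, q.2) := by
  rw [fieldInChart_eq hq]
  refine (tangentCoordChange_tangent_liouville ((tchart x₀).map_target hq)).trans ?_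
  rw [(tchart x₀).right_inv hq]

lemma fieldInChart_fst
    (hS : ∀ v ∈ slit n M, almostTangent v (S v) = liouville v) (hq : q ∈ slitTarget (n := n) x₀) :
    (fieldInChart S x₀ q).1 = q.2 := by
  rw [fieldInChart_eq hq.1]
  refine (tangentCoordChange_tangent_fst ((tchart x₀).map_target hq.1) _).trans ?_
  have h1 := congrArg Prod.snd (hS _ (tchart_symm_mem_slit hq))
  have h2 : (show EuclideanSpace ℝ (Fin n) × EuclideanSpace ℝ (Fin n) from
    S ((tchart x₀).symm q)).1 = ((tchart x₀).symm q).2 := h1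
  refine (congrArg _ h2).trans ?_
  exact congrArg Prod.snd ((tchart x₀).right_inv hq.1)

lemma fieldInChart_eq_sprayOf
    (hS : ∀ v ∈ slit n M, almostTangent v (S v) = liouville v) (hq : q ∈ slitTarget (n := n) x₀) :
    fieldInChart S x₀ q = sprayOf (coeff S x₀) q := by
  refine Prod.ext (fieldInChart_fst hS hq) ?_
  simp only [sprayOf, coeff]
  module

lemma coeff_deform (P : TangentBundle (𝓡 n) M → ℝ) (hq : q ∈ (tchart (n := n) x₀).target) :
    coeff (deform S P) x₀ q = coeff S x₀ q + (P ∘ (tchart x₀).symm) q • q.2 := by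
  have h : fieldInChart (deform S P) x₀ q = fieldInChart S x₀ q
      - (2 * P ((tchart x₀).symm q)) • fieldInChart (liouville (n := n) (M := M)) x₀ q := by
    simp only [fieldInChart, deform]
    exact (map_sub _ _ _).trans (congrArg _ (map_smul _ _ _))
  simp only [coeff, h, fieldInChart_liouville hq, Function.comp_apply, Prod.snd_sub, Prod.smul_snd]
  module

open VectorField

lemma mpullback_tchart_symm (hq : q ∈ (tchart (n := n) x₀).target) :
    mpullback 𝓘(ℝ, EuclideanSpace ℝ (Fin n) × EuclideanSpace ℝ (Fin n)) (𝓡 n).tangent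
      (tchart x₀).symm S q = fieldInChart S x₀ q := by
  have h1 := mfderiv_extChartAt_comp_mfderivWithin_extChartAt_symm (I := (𝓡 n).tangent)
    (x := (⟨x₀, 0⟩ : TangentBundle (𝓡 n) M)) hq
  have h2 := mfderivWithin_extChartAt_symm_comp_mfderiv_extChartAt (I := (𝓡 n).tangent)
    (x := (⟨x₀, 0⟩ : TangentBundle (𝓡 n) M)) hq
  rw [ModelWithCorners.range_eq_univ, mfderivWithin_univ] at h1 h2
  rw [mpullback_apply]
  exact congrArg (fun L => L (S ((tchart x₀).symm q))) (ContinuousLinearMap.inverse_eq h2 h1)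

lemma contDiffAt_fieldInChart
    (hS : ContMDiffOn (𝓡 n).tangent (𝓡 n).tangent.tangent ∞
      (fun v => (⟨v, S v⟩ : TangentBundle (𝓡 n).tangent (TangentBundle (𝓡 n) M))) (slit n M))
    (hq : q ∈ slitTarget (n := n) x₀) : ContDiffAt ℝ ∞ (fieldInChart S x₀) q := by
  have hinv : (mfderiv 𝓘(ℝ, EuclideanSpace ℝ (Fin n) × EuclideanSpace ℝ (Fin n)) (𝓡 n).tangent
      (tchart (n := n) x₀).symm q).IsInvertible := by
    have := isInvertible_mfderivWithin_extChartAt_symm (I := (𝓡 n).tangent)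
      (x := (⟨x₀, 0⟩ : TangentBundle (𝓡 n) M)) hq.1
    rwa [ModelWithCorners.range_eq_univ, mfderivWithin_univ] at this
  have h := ContMDiffAt.mpullback_vectorField_preimage
    (hS.contMDiffAt (isOpen_slit.mem_nhds (tchart_symm_mem_slit hq)))
    (contMDiffAt_tchart_symm hq.1) hinv (by simp)
  rw [contMDiffAt_vectorSpace_iff_contDiffAt] at h
  refine h.congr_of_eventuallyEq ?_
  filter_upwards [(isOpen_tchart_target x₀).mem_nhds hq.1] with p hp
  exact (mpullback_tchart_symm hp).symm

lemma contDiffAt_coeff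
    (hS : ContMDiffOn (𝓡 n).tangent (𝓡 n).tangent.tangent ∞
      (fun v => (⟨v, S v⟩ : TangentBundle (𝓡 n).tangent (TangentBundle (𝓡 n) M))) (slit n M))
    (hq : q ∈ slitTarget (n := n) x₀) : ContDiffAt ℝ ∞ (coeff S x₀) q :=
  (contDiffAt_snd.comp q (contDiffAt_fieldInChart hS hq)).const_smul (-(1 / 2) : ℝ)

/-- Near `v` the Liouville field is the pullback by a chart of the smooth field `(0, y)`. The
bracket formula under pullback needs this regularity. -/
lemma mdifferentiableAt_liouville (v : TangentBundle (𝓡 n) M) :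
    MDifferentiableAt (𝓡 n).tangent (𝓡 n).tangent.tangent
      (fun v => (⟨v, liouville v⟩ : TangentBundle (𝓡 n).tangent (TangentBundle (𝓡 n) M))) v := by
  set Y : ∀ p : EuclideanSpace ℝ (Fin n) × EuclideanSpace ℝ (Fin n),
    TangentSpace 𝓘(ℝ, EuclideanSpace ℝ (Fin n) × EuclideanSpace ℝ (Fin n)) p :=
    fun p => ((0, p.2) : EuclideanSpace ℝ (Fin n) × EuclideanSpace ℝ (Fin n)) with hY
  have hYs : ContMDiffAt 𝓘(ℝ, EuclideanSpace ℝ (Fin n) × EuclideanSpace ℝ (Fin n))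
      𝓘(ℝ, EuclideanSpace ℝ (Fin n) × EuclideanSpace ℝ (Fin n)).tangent ∞
      (fun p => (⟨p, Y p⟩ : TangentBundle
        𝓘(ℝ, EuclideanSpace ℝ (Fin n) × EuclideanSpace ℝ (Fin n)) _)) (tchart v.proj v) :=
    contMDiffAt_vectorSpace_iff_contDiffAt.2 (contDiffAt_const.prodMk contDiffAt_snd)
  have hinv : ∀ w ∈ (tchart (n := n) v.proj).source, (mfderiv (𝓡 n).tangent
      𝓘(ℝ, EuclideanSpace ℝ (Fin n) × EuclideanSpace ℝ (Fin n))
      (tchart (n := n) v.proj) w).IsInvertible := fun w hw =>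
    isInvertible_mfderiv_extChartAt hw
  have h := ContMDiffAt.mpullback_vectorField_preimage hYs
    (contMDiffAt_tchart (mem_tchart_source_self v)) (hinv v (mem_tchart_source_self v)) (by simp)
  refine (h.mdifferentiableAt (by simp)).congr_of_eventuallyEq ?_
  filter_upwards [extChartAt_source_mem_nhds (I := (𝓡 n).tangent) v] with w hw
  congr 1
  rw [mpullback_apply]
  obtain ⟨e, he⟩ := hinv w hw
  have hl : e (liouville w) = Y (tchart v.proj w) := by
    have := tangentCoordChange_tangent_liouville (x₀ := v.proj) hw
    rw [← mfderiv_tchart hw, ← he] at this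
    exact this
  rw [← he, ContinuousLinearMap.inverse_equiv, ← hl]
  exact (e.symm_apply_apply _).symm

lemma mlieBracket_eq_lieBracket {V : Type*} [NormedAddCommGroup V] [NormedSpace ℝ V]
    (X Y : ∀ p : V, TangentSpace 𝓘(ℝ, V) p) :
    mlieBracket 𝓘(ℝ, V) X Y = lieBracket ℝ X Y := by
  rw [← mlieBracketWithin_univ, mlieBracketWithin_eq_lieBracketWithin]
  exact lieBracketWithin_univ

/-- This is the coordinate content of `[C, S] = S`: for `C = (0, y)` and `S = (y, -2G)`, the fibre
part of the bracket is `-2 G_y + 2G`, where `G_y` is the fibre derivative along `y`. -/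
lemma vert_coeff_self (hS : IsSpray S) (hq : q ∈ slitTarget (n := n) x₀) :
    vert (coeff S x₀) q q.2 = (2 : ℝ) • coeff S x₀ q := by
  have hv := tchart_symm_mem_slit hq
  have hSd : MDifferentiableAt (𝓡 n).tangent (𝓡 n).tangent.tangent
      (fun v => (⟨v, S v⟩ : TangentBundle (𝓡 n).tangent (TangentBundle (𝓡 n) M)))
      ((tchart x₀).symm q) :=
    (hS.smooth.contMDiffAt (isOpen_slit.mem_nhds hv)).mdifferentiableAt (by simp)
  have htwo : minSmoothness ℝ 2 ≤ (∞ : WithTop ℕ∞) := by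
    simpa using WithTop.coe_le_coe.2 (le_top : (2 : ℕ∞) ≤ ⊤)
  have : IsManifold (𝓡 n).tangent (minSmoothness ℝ 2) (TangentBundle (𝓡 n) M) :=
    IsManifold.of_le (n := ∞) htwo
  have h := mpullback_mlieBracket (mdifferentiableAt_liouville _) hSd
    (contMDiffAt_tchart_symm hq.1) htwo
  have e1 : fieldInChart (mlieBracket (𝓡 n).tangent liouville S) x₀ q = fieldInChart S x₀ q := by
    rw [fieldInChart, hS.bracket_eq _ hv]; rfl
  have hmem := (isOpen_slitTarget x₀).mem_nhds hq
  have e2 := Filter.EventuallyEq.lieBracket_vectorField_eq (𝕜 := ℝ)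
    (Filter.eventuallyEq_of_mem hmem fun p hp =>
      (mpullback_tchart_symm (S := liouville) hp.1).trans (fieldInChart_liouville hp.1))
    (Filter.eventuallyEq_of_mem hmem fun p hp =>
      (mpullback_tchart_symm (S := S) hp.1).trans
        (fieldInChart_eq_sprayOf hS.almostTangent_eq hp))
  have e3 := ((mpullback_tchart_symm hq.1).symm.trans h).trans
    ((congrFun (mlieBracket_eq_lieBracket _ _) q).trans e2)
  have hGd := (contDiffAt_coeff hS.smooth hq).differentiableAt_infty
  have hC : HasFDerivAt (fun p : EuclideanSpace ℝ (Fin n) × EuclideanSpace ℝ (Fin n) =>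
      ((0 : EuclideanSpace ℝ (Fin n)), p.2))
      ((0 : EuclideanSpace ℝ (Fin n) × EuclideanSpace ℝ (Fin n) →L[ℝ] EuclideanSpace ℝ (Fin n)).prod
        (ContinuousLinearMap.snd ℝ _ _)) q :=
    (hasFDerivAt_const _ q).prodMk hasFDerivAt_snd
  rw [e1, fieldInChart_eq_sprayOf hS.almostTangent_eq hq, lieBracket, fderiv_sprayOf hGd,
    hC.fderiv] at e3
  have e4 := congrArg Prod.snd e3
  simp only [sprayOf, Prod.snd_sub, ContinuousLinearMap.prod_apply, ContinuousLinearMap.coe_snd',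
    ← vert_apply] at e4
  have e5 : (2 : ℝ) • (vert (coeff S x₀) q q.2 - (2 : ℝ) • coeff S x₀ q) = 0 := by
    have e6 := sub_eq_zero.2 e4
    refine Eq.trans ?_ e6
    module
  exact sub_eq_zero.1 ((smul_eq_zero.1 e5).resolve_left two_ne_zero)

end

/-! ### Finsler energies, holonomy invariance and principal curvatures in coordinates. -/

section

variable {n : ℕ} {M : Type*} [TopologicalSpace M] [ChartedSpace (EuclideanSpace ℝ (Fin n)) M]
  [IsManifold (𝓡 n) ∞ M]
  {S : ∀ v : TangentBundle (𝓡 n) M, TangentSpace (𝓡 n).tangent v}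
  {F P : TangentBundle (𝓡 n) M → ℝ}
  {x₀ : M} {q : EuclideanSpace ℝ (Fin n) × EuclideanSpace ℝ (Fin n)}

lemma contMDiffOn_energy (hF : IsFinsler F) :
    ContMDiffOn (𝓡 n).tangent 𝓘(ℝ, ℝ) ∞ (energy F) (slit n M) := by
  have h : ContDiff ℝ ∞ (fun r : ℝ => r ^ 2 / 2) := by fun_prop
  exact h.contMDiff.comp_contMDiffOn hF.smooth

lemma energy_pos (hF : IsFinsler F) (hq : q ∈ slitTarget (n := n) x₀) :
    0 < (energy F ∘ (tchart x₀).symm) q := by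
  have := hF.pos _ (tchart_symm_mem_slit hq)
  simp only [Function.comp_apply, energy]
  positivity

lemma vert_energy_self (hF : IsFinsler F) (hq : q ∈ slitTarget (n := n) x₀) :
    vert (energy F ∘ (tchart x₀).symm) q q.2 = (2 : ℝ) • (energy F ∘ (tchart x₀).symm) q := by
  have hd := (contDiffAt_comp_tchart_symm (contMDiffOn_energy hF) hq).differentiableAt_infty
  refine (fderiv_snd_of_homogeneous 2 hd fun t ht => ?_).trans (by norm_num)
  have hq' := smul_mem_slitTarget hq ht.ne'
  have h1 : F ((tchart x₀).symm (q.1, t • q.2)) = t * F ((tchart x₀).symm q) := by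
    rw [tchart_symm_apply hq'.1, tchart_symm_apply hq.1]
    refine Eq.trans ?_ (hF.homogeneous _ _ t ht)
    exact congrArg (fun y : EuclideanSpace ℝ (Fin n) => F (⟨(extChartAt (𝓡 n) x₀).symm q.1, y⟩ :
      TangentBundle (𝓡 n) M)) (map_smul _ t q.2)
  simp only [Function.comp_apply, energy, h1, smul_eq_mul]
  ring

/-- The energy of `F` is constant along the horizontal directions of its geodesic spray. -/
lemma fderiv_energy_hlift (hF : IsFinsler F) (hS : IsGeodesicSpray F S)
    (hq : q ∈ slitTarget (n := n) x₀) (u : EuclideanSpace ℝ (Fin n)) :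
    fderiv ℝ (energy F ∘ (tchart x₀).symm) q (hlift (coeff S x₀) q u) = 0 := by
  refine fderiv_hlift_eq_zero_of_eulerLagrange (isOpen_slitTarget x₀)
    (fun p hp => contDiffAt_coeff hS.isSpray.smooth hp)
    (fun p hp => contDiffAt_comp_tchart_symm (contMDiffOn_energy hF) hp)
    (fun p hp => vert_energy_self hF hp) (fun p hp u => ?_) hq u
  have h := hS.eulerLagrange x₀ p hp.1 hp.2 (u, 0)
  have hs := contDiffAt_comp_tchart_symm (contMDiffOn_energy hF) hp
  have hJ : ∀ a η, fderiv ℝ (dJ (energy F ∘ (tchart x₀).symm)) p a η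
      = fderiv ℝ (fderiv ℝ (energy F ∘ (tchart x₀).symm)) p a (0, η.1) := by
    intro a η
    have e : dJ (energy F ∘ (tchart x₀).symm) = fun r =>
      (fderiv ℝ (energy F ∘ (tchart x₀).symm) r).comp
        ((ContinuousLinearMap.inr ℝ _ _).comp (ContinuousLinearMap.fst ℝ _ _)) := rfl
    rw [e, fderiv_clm_comp hs.fderiv_infty.differentiableAt_infty (differentiableAt_const _)]
    simp
  rw [hJ, hJ, fieldInChart_eq_sprayOf hS.isSpray.almostTangent_eq hp] at h
  exact h

/-- The fibre Hessian of the energy of a Finsler function is nondegenerate in coordinates. -/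
lemma energy_nondegenerate (hF : IsFinsler F) (hq : q ∈ slitTarget (n := n) x₀)
    (u : EuclideanSpace ℝ (Fin n))
    (hu : ∀ w, fderiv ℝ (fderiv ℝ (energy F ∘ (tchart x₀).symm)) q (0, u) (0, w) = 0) :
    u = 0 := by
  set f := energy F ∘ (tchart x₀).symm with hf
  set x := (extChartAt (𝓡 n) x₀).symm q.1 with hx
  have hxs : x ∈ (extChartAt (𝓡 n) x₀).source :=
    (extChartAt (𝓡 n) x₀).map_target (mem_tchart_target.1 hq.1)
  -- `metricTensor` uses the fibre coordinate of the preferred chart at `x`, while `f` uses that of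
  -- the chart at `x₀`; the inverse linear maps `L` and `K` intertwine the two Hessians.
  set L : EuclideanSpace ℝ (Fin n) →L[ℝ] EuclideanSpace ℝ (Fin n) :=
    tangentCoordChange (𝓡 n) x₀ x x
  set K : EuclideanSpace ℝ (Fin n) →L[ℝ] EuclideanSpace ℝ (Fin n) :=
    tangentCoordChange (𝓡 n) x x₀ x
  have hKL : ∀ y, K (L y) = y := tangentCoordChange_symm_apply hxs
  have hLK : ∀ y, L (K y) = y := tangentCoordChange_apply_symm hxs
  set g : EuclideanSpace ℝ (Fin n) → ℝ := fun z => energy F (⟨x, z⟩ : TangentBundle (𝓡 n) M)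
  have hgf : g = fun z => f (q.1, K z) := by
    funext z
    have ht : (q.1, K z) ∈ (tchart (n := n) x₀).target :=
      mem_tchart_target.2 (mem_tchart_target.1 hq.1)
    simp only [g, hf, Function.comp_apply]
    rw [tchart_symm_apply ht]
    exact congrArg (fun y => energy F (⟨x, y⟩ : TangentBundle (𝓡 n) M)) (hLK z).symm
  have hι : ∀ z, HasFDerivAt (fun z => (q.1, K z)) ((ContinuousLinearMap.inr ℝ
      (EuclideanSpace ℝ (Fin n)) (EuclideanSpace ℝ (Fin n))).comp K) z := fun z =>
    (hasFDerivAt_const q.1 z).prodMk K.hasFDerivAt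
  have hmem : ∀ z, z ≠ 0 → (q.1, K z) ∈ slitTarget (n := n) x₀ := fun z hz =>
    ⟨mem_tchart_target.2 (mem_tchart_target.1 hq.1),
      fun h => hz (by rw [← hLK z, show K z = 0 from h, map_zero])⟩
  have hfs : ∀ p ∈ slitTarget (n := n) x₀, ContDiffAt ℝ ∞ f p := fun p hp =>
    contDiffAt_comp_tchart_symm (contMDiffOn_energy hF) hp
  have hy : L q.2 ≠ 0 := fun h => hq.2 (by rw [← hKL q.2, h, map_zero])
  have hqK : (q.1, K (L q.2)) = q := by rw [hKL]
  have hg1 : ∀ z ∈ ({0}ᶜ : Set (EuclideanSpace ℝ (Fin n))), fderiv ℝ g z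
      = (fderiv ℝ f (q.1, K z)).comp ((ContinuousLinearMap.inr ℝ _ _).comp K) := by
    intro z hz
    rw [hgf]
    exact ((hfs _ (hmem z hz)).differentiableAt_infty.hasFDerivAt.comp z (hι z)).fderiv
  have hg2 : ∀ a b, fderiv ℝ (fderiv ℝ g) (L q.2) a b
      = fderiv ℝ (fderiv ℝ f) q (0, K a) (0, K b) := by
    intro a b
    rw [fderiv_eq_of_eqOn isOpen_compl_singleton hg1 hy]
    have hd : HasFDerivAt (fun z => fderiv ℝ f (q.1, K z)) _ (L q.2) :=
      HasFDerivAt.comp (g := fderiv ℝ f) (f := fun z => (q.1, K z)) (L q.2)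
        (hfs _ (hmem _ hy)).fderiv_infty.differentiableAt_infty.hasFDerivAt (hι _)
    rw [fderiv_clm_comp hd.differentiableAt (differentiableAt_const _), hd.fderiv, hqK]
    simp
  have h0 : L u = 0 := by
    refine hF.nondegenerate x (L q.2) hy (L u) fun w => ?_
    refine (hg2 (L u) w).trans ?_
    rw [hKL, hu]
  rw [← hKL u, h0, map_zero]

/-- A holonomy invariant function has vanishing horizontal derivatives. -/
lemma fderiv_hlift_of_isHolonomyInvariant (hS : IsSpray S)
    (hPs : ContMDiffOn (𝓡 n).tangent 𝓘(ℝ, ℝ) ∞ P (slit n M)) (hP : IsHolonomyInvariant S P)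
    (hq : q ∈ slitTarget (n := n) x₀) (u : EuclideanSpace ℝ (Fin n)) :
    fderiv ℝ (P ∘ (tchart x₀).symm) q (hlift (coeff S x₀) q u) = 0 := by
  have hX : ∀ p ∈ slitTarget (n := n) x₀,
      ContDiffAt ℝ 1 (fun p => hlift (coeff S x₀) p u) p := fun p hp =>
    contDiffAt_const.prodMk
      (((ContDiffAt.vert (contDiffAt_coeff hS.smooth hp)).of_le (by simp)).clm_apply
        contDiffAt_const).neg
  -- An integral curve of the horizontal lift of the constant field `u` is parallel, so `P` is
  -- constant along it; its velocity at `0` is the required direction.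
  obtain ⟨α, hα0, ε, hε, hα⟩ :=
    (hX q hq).exists_forall_mem_closedBall_exists_eq_forall_mem_Ioo_hasDerivAt₀ 0
  simp only [zero_sub, zero_add] at hα
  have hαc : ContinuousAt α 0 := (hα 0 ⟨by linarith, hε⟩).continuousAt
  obtain ⟨δ, hδ, hδs⟩ := Metric.mem_nhds_iff.1 (Filter.inter_mem (hαc.preimage_mem_nhds
    (by rw [hα0]; exact (isOpen_slitTarget x₀).mem_nhds hq))
    (Ioo_mem_nhds (neg_lt_zero.2 hε) hε))
  rw [Real.ball_eq_Ioo, zero_sub, zero_add] at hδs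
  have hαd : ∀ t ∈ Set.Ioo (-δ) δ, HasDerivAt α (hlift (coeff S x₀) (α t) u) t :=
    fun t ht => hα t (hδs ht).2
  have hmem : ∀ t ∈ Set.Ioo (-δ) δ, α t ∈ slitTarget (n := n) x₀ := fun t ht => (hδs ht).1
  -- `IsParallel` requires a `C¹` curve, so continuity of the velocity is read off from the
  -- differential equation.
  have hα1 : ∀ t ∈ Set.Ioo (-δ) δ, ContDiffAt ℝ 1 α t := by
    intro t ht
    refine contDiffAt_one_iff.2 ⟨fun s => ContinuousLinearMap.toSpanSingleton ℝ
      (hlift (coeff S x₀) (α s) u), Set.Ioo (-δ) δ, isOpen_Ioo.mem_nhds ht, ?_, fun s hs =>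
      (hαd s hs).hasFDerivAt⟩
    intro s hs
    have c1 : ContinuousAt (fun s => hlift (coeff S x₀) (α s) u) s :=
      ContinuousAt.comp (g := fun p => hlift (coeff S x₀) p u) (hX _ (hmem s hs)).continuousAt
        (hαd s hs).continuousAt
    exact ((ContinuousLinearMap.toSpanSingletonCLE (𝕜 := ℝ)
      (E := EuclideanSpace ℝ (Fin n) × EuclideanSpace ℝ (Fin n))).continuous.continuousAt.comp
      c1).continuousWithinAt
  have hpar : ∀ a b, -δ < a → b < δ → IsParallel S (fun t => (tchart x₀).symm (α t)) a b := by
    intro a b ha hb t ht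
    have ht' : t ∈ Set.Ioo (-δ) δ := ⟨ha.trans_le ht.1, ht.2.trans_lt hb⟩
    have hm := hmem t ht'
    refine ⟨tchart_symm_mem_slit hm, ?_, x₀, (tchart x₀).map_target hm.1, ?_⟩
    · exact ((contMDiffAt_tchart_symm hm.1).of_le (by simp)).comp t
        (contMDiffAt_iff_contDiffAt.2 (hα1 t ht'))
    · have he : (fun s => tchart x₀ ((tchart x₀).symm (α s))) =ᶠ[𝓝 t] α := by
        filter_upwards [isOpen_Ioo.mem_nhds ht'] with s hs
        exact (tchart x₀).right_inv (hmem s hs).1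
      rw [he.deriv_eq, (hαd t ht').deriv, (tchart x₀).right_inv hm.1]
      exact neg_add_cancel _
  have hconst : ∀ t ∈ Set.Ioo (-δ) δ,
      (P ∘ (tchart x₀).symm) (α t) = (P ∘ (tchart x₀).symm) (α 0) := by
    intro t ht
    rcases le_total t 0 with h | h
    · exact hP _ t 0 h (hpar t 0 ht.1 hδ)
    · exact (hP _ 0 t h (hpar 0 t (neg_lt_zero.2 hδ) ht.2)).symm
  have hd := (contDiffAt_comp_tchart_symm hPs hq).differentiableAt_infty.hasFDerivAt
  rw [← hα0] at hd
  have h0 : (0 : ℝ) ∈ Set.Ioo (-δ) δ := ⟨neg_lt_zero.2 hδ, hδ⟩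
  have h1 := hd.comp_hasDerivAt (0 : ℝ) (hαd 0 h0)
  have h2 := (hasDerivAt_const (0 : ℝ) ((P ∘ (tchart x₀).symm) (α 0))).congr_of_eventuallyEq
    (Filter.eventuallyEq_of_mem (isOpen_Ioo.mem_nhds h0) hconst)
  have h3 := h1.unique h2
  rwa [hα0] at h3

/-- The connection coefficients of the deformed spray. -/
lemma vert_coeff_deform (hS : IsSpray S)
    (hPs : ContMDiffOn (𝓡 n).tangent 𝓘(ℝ, ℝ) ∞ P (slit n M)) (hq : q ∈ slitTarget (n := n) x₀)
    (u : EuclideanSpace ℝ (Fin n)) :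
    vert (coeff (deform S P) x₀) q u = vert (coeff S x₀) q u
      + ((P ∘ (tchart x₀).symm) q • u + vert (P ∘ (tchart x₀).symm) q u • q.2) := by
  have hG := (contDiffAt_coeff hS.smooth hq).differentiableAt_infty
  have hP := (contDiffAt_comp_tchart_symm hPs hq).differentiableAt_infty
  rw [vert_apply, fderiv_eq_of_eqOn (isOpen_slitTarget x₀) (fun p hp => coeff_deform P hp.1) hq,
    fderiv_fun_add hG (hP.fun_smul differentiableAt_snd), fderiv_fun_smul hP differentiableAt_snd,
    fderiv_snd]
  rfl

/-- The projective factor of a deformation that is a spray is positively homogeneous. -/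
lemma vert_projectiveFactor_self (hS : IsSpray S) (hS' : IsSpray (deform S P))
    (hPs : ContMDiffOn (𝓡 n).tangent 𝓘(ℝ, ℝ) ∞ P (slit n M))
    (hq : q ∈ slitTarget (n := n) x₀) :
    vert (P ∘ (tchart x₀).symm) q q.2 = (P ∘ (tchart x₀).symm) q := by
  have h1 := vert_coeff_self hS hq
  have h2 := vert_coeff_self hS' hq
  rw [vert_coeff_deform hS hPs hq, h1, coeff_deform P hq.1] at h2
  have h3 : (vert (P ∘ (tchart x₀).symm) q q.2 - (P ∘ (tchart x₀).symm) q) • q.2 = 0 := by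
    refine Eq.trans ?_ (sub_eq_zero.2 h2)
    module
  exact sub_eq_zero.1 ((smul_eq_zero.1 h3).resolve_right hq.2)

/-- The two operators differ only in the field along which the connection is differentiated, and for
a spray these fields agree. -/
lemma jacobi_eq_jac (hS : IsSpray S) (hq : q ∈ slitTarget (n := n) x₀) :
    jacobi S x₀ q = jac (coeff S x₀) q := by
  rw [jacobi, fieldInChart_eq_sprayOf hS.almostTangent_eq hq]
  rfl

lemma tchart_mem_closure {v : TangentBundle (𝓡 n) M} (hx : v ∈ (tchart (n := n) x₀).source)
    (hcl : v ∈ closure {u | u ∈ slit n M ∧ P u ≠ 0}) :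
    tchart x₀ v ∈ closure {p | p ∈ slitTarget (n := n) x₀ ∧ (P ∘ (tchart x₀).symm) p ≠ 0} := by
  rw [mem_closure_iff_nhds] at hcl ⊢
  intro N hN
  have hc : ContinuousAt (tchart (n := n) x₀) v := (contMDiffAt_tchart hx).continuousAt
  obtain ⟨w, ⟨hwN, hws⟩, hw, hPw⟩ := hcl _ (Filter.inter_mem (hc.preimage_mem_nhds hN)
    ((isOpen_extChartAt_source (I := (𝓡 n).tangent)
      (⟨x₀, 0⟩ : TangentBundle (𝓡 n) M)).mem_nhds hx))
  refine ⟨tchart x₀ w, hwN, tchart_mem_slitTarget hw hws, ?_⟩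
  rwa [Function.comp_apply, (tchart x₀).left_inv hws]

/-- If the deformation of a geodesic spray by a holonomy invariant function `P` is metrizable, then
`-P²` is a principal curvature on the closure of the set where `P` does not vanish. -/
theorem isPrincipalCurvatureAt_neg_sq (hn : 2 ≤ n) (hF : IsFinsler F) (hS : IsGeodesicSpray F S)
    (hPs : ContMDiffOn (𝓡 n).tangent 𝓘(ℝ, ℝ) ∞ P (slit n M)) (hP : IsHolonomyInvariant S P)
    (hmet : IsMetrizable (deform S P)) {v : TangentBundle (𝓡 n) M} (hv : v ∈ slit n M)
    (hcl : v ∈ closure {u | u ∈ slit n M ∧ P u ≠ 0}) :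
    IsPrincipalCurvatureAt S v (-(P v) ^ 2) := by
  obtain ⟨F', hF', hS'⟩ := hmet
  intro x₀ hx
  have hq := tchart_mem_slitTarget hv hx
  have hPh : ∀ p ∈ slitTarget (n := n) x₀, ∀ u,
      fderiv ℝ (P ∘ (tchart x₀).symm) p (hlift (coeff S x₀) p u) = 0 := fun p hp u =>
    fderiv_hlift_of_isHolonomyInvariant hS.isSpray hPs hP hp u
  have hfh : ∀ p ∈ slitTarget (n := n) x₀, ∀ u,
      fderiv ℝ (energy F' ∘ (tchart x₀).symm) p (hlift (coeff S x₀) p u)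
        = (P ∘ (tchart x₀).symm) p * vert (energy F' ∘ (tchart x₀).symm) p u
          + 2 * (energy F' ∘ (tchart x₀).symm) p * vert (P ∘ (tchart x₀).symm) p u := by
    intro p hp u
    -- The energy of `F'` is constant along the deformed horizontal lift. Moving the vertical
    -- correction to the other side, with Euler's relation for its `y` component, gives the
    -- derivative along the original lift.
    have h1 := fderiv_energy_hlift hF' hS' hp u
    have h2 := vert_energy_self hF' hp
    have h3 : hlift (coeff (deform S P) x₀) p u = hlift (coeff S x₀) p u
        - (0, (P ∘ (tchart x₀).symm) p • u + vert (P ∘ (tchart x₀).symm) p u • p.2) := by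
      simp only [hlift, vert_coeff_deform hS.isSpray hPs hp]
      ext1
      · simp
      · simp only [Prod.snd_sub]; module
    rw [h3, map_sub, ← vert_apply, map_add, map_smul, map_smul, h2] at h1
    simp only [smul_eq_mul] at h1
    linarith
  obtain ⟨X, hX, hRX⟩ := exists_jac_eigenvector (V := EuclideanSpace ℝ (Fin n))
    (by rwa [finrank_euclideanSpace_fin]) (isOpen_slitTarget x₀)
    (fun p hp => contDiffAt_coeff hS.isSpray.smooth hp)
    (fun p hp => vert_coeff_self hS.isSpray hp)
    (fun p hp => contDiffAt_comp_tchart_symm hPs hp)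
    (fun p hp => vert_projectiveFactor_self hS.isSpray hS'.isSpray hPs hp) hPh
    (fun p hp => contDiffAt_comp_tchart_symm (contMDiffOn_energy hF') hp)
    (fun p hp => vert_energy_self hF' hp) hfh (fun p hp => energy_pos hF' hp)
    (fun p hp u hu => energy_nondegenerate hF' hp u hu)
    (fun p hp => contDiffAt_comp_tchart_symm (contMDiffOn_energy hF) hp)
    (fun p hp => vert_energy_self hF hp) (fun p hp u => fderiv_energy_hlift hF hS hp u)
    (fun p hp => energy_pos hF hp) hq (tchart_mem_closure hx hcl)
  refine ⟨X, hX, ?_⟩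
  rw [jacobi_eq_jac hS.isSpray hq, hRX, Function.comp_apply, (tchart x₀).left_inv hx]

/-- A principal curvature appears in every complete list of principal curvatures. -/
lemma IsPrincipalCurvatureAt.exists_eq (hS : IsSpray S) {v : TangentBundle (𝓡 n) M}
    (hv : v ∈ slit n M) {κ : ℝ} (hκ : IsPrincipalCurvatureAt S v κ) {c : Fin (n - 1) → ℝ}
    (hc : IsPrincipalCurvatureList S v c) : ∃ i, c i = κ := by
  obtain ⟨x₀, hx, X, hli, hX⟩ := hc
  obtain ⟨Z, hZ, hRZ⟩ := hκ x₀ hx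
  have hq := tchart_mem_slitTarget hv hx
  set y := (tchart (n := n) x₀ v).2 with hy
  have hRy : jacobi S x₀ (tchart x₀ v) y = 0 := by
    rw [jacobi_eq_jac hS hq]
    exact jac_self (isOpen_slitTarget x₀) (fun p hp => contDiffAt_coeff hS.smooth hp)
      (fun p hp => vert_coeff_self hS hp) hq
  -- Positivity of `n` makes the truncated `n - 1` satisfy `(n - 1) + 1 = n`, so that `y` and the `X
  -- i` form a basis.
  have hn : 0 < n := by
    rcases Nat.eq_zero_or_pos n with rfl | h
    · exact absurd (Subsingleton.elim y 0) hq.2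
    · exact h
  have hcard : Fintype.card (Option (Fin (n - 1)))
      = Module.finrank ℝ (EuclideanSpace ℝ (Fin n)) := by
    rw [Fintype.card_option, Fintype.card_fin, finrank_euclideanSpace_fin]
    omega
  set b := basisOfLinearIndependentOfCardEqFinrank hli hcard with hb
  have hbs : ∀ o : Option (Fin (n - 1)), b o = o.elim y X := fun o => by
    rw [hb, coe_basisOfLinearIndependentOfCardEqFinrank]
  have hsum : Z = b.repr Z none • y + ∑ i, b.repr Z (some i) • X i := by
    have h := b.sum_repr Z
    rw [Fintype.sum_option] at h
    simpa only [hbs, Option.elim] using h.symm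
  have hRsum : jacobi S x₀ (tchart x₀ v) Z = ∑ i, (b.repr Z (some i) * c i) • X i := by
    conv_lhs => rw [hsum]
    rw [map_add, map_smul, hRy, smul_zero, zero_add, map_sum]
    simp only [map_smul, hX, smul_smul]
  -- Comparing coordinates in `R Z = κ Z`: any nonzero coordinate along `X i` forces `c i = κ`, and
  -- one exists because `Z` is not a multiple of `y`.
  have hcoord : ∀ i, b.repr Z (some i) * c i = κ * b.repr Z (some i) := by
    intro i
    have h1 : b.repr (jacobi S x₀ (tchart x₀ v) Z) (some i) = κ * b.repr Z (some i) := by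
      rw [hRZ]; simp
    rw [← h1, hRsum]
    have h2 : ∀ j, X j = b (some j) := fun j => (hbs (some j)).symm
    simp [h2, Finsupp.single_apply]
  obtain ⟨i, hi⟩ : ∃ i, b.repr Z (some i) ≠ 0 := by
    by_contra! h
    apply hZ
    rw [hsum]
    simp only [h, zero_smul, Finset.sum_const_zero, add_zero]
    exact Submodule.smul_mem _ _ (Submodule.mem_span_singleton_self y)
  exact ⟨i, mul_left_cancel₀ hi (by rw [hcoord, mul_comm])⟩

end

end FinslerSpray

end

theorem mainTheorem4 {n : ℕ} (hn : 2 ≤ n) {M : Type*} [TopologicalSpace M]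
    [ChartedSpace (EuclideanSpace ℝ (Fin n)) M] [IsManifold (𝓡 n) ∞ M]
    (F : TangentBundle (𝓡 n) M → ℝ) (hF : FinslerSpray.IsFinsler F)
    (S : ∀ v : TangentBundle (𝓡 n) M, TangentSpace (𝓡 n).tangent v)
    (hS : FinslerSpray.IsGeodesicSpray F S)
    (P : TangentBundle (𝓡 n) M → ℝ)
    (hPsmooth : ContMDiffOn (𝓡 n).tangent 𝓘(ℝ, ℝ) ∞ P (FinslerSpray.slit n M))
    (hPhol : FinslerSpray.IsHolonomyInvariant S P)
    (hP : ∃ v ∈ FinslerSpray.slit n M, P v ≠ 0) :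
    (FinslerSpray.IsMetrizable (FinslerSpray.deform S P) →
      ∃ κ : TangentBundle (𝓡 n) M → ℝ,
        ContMDiffOn (𝓡 n).tangent 𝓘(ℝ, ℝ) ∞ κ (FinslerSpray.slit n M) ∧
        ∀ v ∈ FinslerSpray.slit n M, v ∈ closure {u | u ∈ FinslerSpray.slit n M ∧ P u ≠ 0} →
          FinslerSpray.IsPrincipalCurvatureAt S v (κ v) ∧
          P v ^ 2 + κ v = 0 ∧
          (P v ≠ 0 → κ v ≠ 0) ∧
          ∀ c : Fin (n - 1) → ℝ, FinslerSpray.IsPrincipalCurvatureList S v c →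
            ∃ α, P v ^ 2 + c α = 0) ∧
    ((∀ v ∈ FinslerSpray.slit n M, ∀ κ : ℝ,
        FinslerSpray.IsPrincipalCurvatureAt S v κ → 0 ≤ κ) →
      ¬ FinslerSpray.IsMetrizable (FinslerSpray.deform S P)) := by
  -- The choice `κ = -P²` is smooth on the whole slit bundle, although it need be a principal
  -- curvature only on the closure.
  refine ⟨fun hmet => ⟨fun v => -(P v) ^ 2, ?_, fun v hv hcl => ?_⟩, fun hnonneg hmet => ?_⟩
  · have h : ContDiff ℝ ∞ (fun r : ℝ => -r ^ 2) := by fun_prop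
    exact h.contMDiff.comp_contMDiffOn hPsmooth
  · have hκ := FinslerSpray.isPrincipalCurvatureAt_neg_sq hn hF hS hPsmooth hPhol hmet hv hcl
    refine ⟨hκ, by ring, fun h => neg_ne_zero.2 (pow_ne_zero 2 h), fun c hc => ?_⟩
    obtain ⟨i, hi⟩ := hκ.exists_eq hS.isSpray hv hc
    exact ⟨i, by rw [hi]; ring⟩
  · obtain ⟨v, hv, hPv⟩ := hP
    have h := hnonneg v hv _ (FinslerSpray.isPrincipalCurvatureAt_neg_sq hn hF hS hPsmooth hPhol
      hmet hv (subset_closure ⟨hv, hPv⟩))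
    have : 0 < P v ^ 2 := by positivity
    linarith
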